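/- **Setting.** Let $n,N\ge 0$, let $G$ be a smooth $N$-dimensional Lie group, $(e_A)_{A=1}^N$ a basis of its Lie algebra $\mathfrak g$, $\tilde e_A$ the left-invariant vector field with value $e_A$ at the identity, and $\lambda=\lambda^A\otimes e_A$ the left Maurer–Cartan form, $\lambda^A(\tilde e_B)=\delta^A_B$. In a local trivialization write the principal $G$-bundle as $E=U\times G$ with $U\subset\mathbb R^{n+1}$ open, coordinates $x^\mu$ $(\mu=1,\dots,n+1)$ on $U$ and local coordinates $y^A$ on an open subset of $G$. A point of $J^1E$ is $(x,g,\xi^A_\mu)$, where the first jet of a section $g$ has $\xi^A_\mu=\lambda^A(\partial g/\partial x^\mu)$; a point of the dual bundle $J^1E^*$ is $(x,g,\pi^\mu_A)$. All functions are smooth and considered over the domain of $(x^\mu,y^A)$. Summation over repeated indices is understood. Put $\omega=dx^1\wedge\dots\wedge dx^{n+1}$, $d^nx_\mu=\partial_\mu\lrcorner\,\omega$, $d^{n-1}x_{\mu\nu}=\partial_\nu\lrcorner\, d^nx_\mu$, $T^B_A=dy^B(\tilde e_A)$, $[\lambda,\lambda](X,Y)=[\lambda(X),\lambda(Y)]$,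 and $\langle \mathrm{ad}^*_\xi\pi,\beta\rangle=\langle\pi,[\xi,\beta]\rangle$. Let $l$ be a reduced Lagrangian on $J^1E$ and $\mathbb F l(x,g,\xi)=(x,g,\partial l/\partial\xi^A_\mu)$ its reduced covariant Legendre transformation, and let $h$ be a Hamiltonian on $J^1E^*$ with $h\circ\mathbb F l=\frac{\partial l}{\partial \xi^A_\mu}\xi^A_\mu-l$. Set $$\Theta_h=\pi^\mu_A\lambda^A\wedge d^nx_\mu-h\,\omega,\qquad \psi^\mu=\lambda^A\wedge d\pi^\mu_A+\pi^\mu_A[\lambda,\lambda]^A,$$ $$\Omega_h^*=\psi^\mu\wedge d^nx_\mu,\qquad \Omega_h=\Omega_h^*+dh\wedge\omega .$$ **Statement.** (1) The forms pull back to the Lagrangian forms: $$(\mathbb F l)^*\Theta_h=\tfrac{\partial l}{\partial\xi^A_\mu}\lambda^A\wedge d^nx_\mu-\bigl(\tfrac{\partial l}{\partial\xi^A_\mu}\xi^A_\mu-l\bigr)\omega,$$ $$(\mathbb F l)^*\Omega_h=\Bigl(\lambda^A\wedge d\tfrac{\partial l}{\partial\xi^A_\mu}+\tfrac{\partial l}{\partial\xi^A_\mu}[\lambda,\lambda]^A\Bigr)\wedge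 d^nx_\mu+\Bigl(\xi^A_\mu\, d\tfrac{\partial l}{\partial\xi^A_\mu}-T^B_A\tfrac{\partial l}{\partial y^B}\lambda^A\Bigr)\wedge\omega .$$ (2) For every smooth section $s(x)=(x,g(x),\pi(x))$ of $J^1E^*\to U$ with $g$ taking values in the domain of the $y^A$, with $X_\mu=Ts(\partial_\mu)$ and $\mathbf X=(X_1,\dots,X_{n+1})$, the following are equivalent: (i) $s$ is Hamiltonian: $s^*(W\lrcorner\,\Omega_h)=0$ for every smooth vector field $W$ on $J^1E^*$; (ii) for all $\nu$, $A$ (and all $\mu$ in the last equation) $$s^*\bigl[dh\wedge d^nx_\nu-\tfrac{\partial h}{\partial x^\nu}\omega-\psi^\mu\wedge d^{n-1}x_{\mu\nu}\bigr]=0\quad\text{(energy balance)},$$ $$s^*\bigl[\bigl(d\pi^\mu_A-(\mathrm{ad}^*_\lambda\pi^\mu)_A+\tfrac1{n+1}T^B_A\tfrac{\partial h}{\partial y^B}dx^\mu\bigr)\wedge d^nx_\mu\bigr]=0,\qquad s^*\bigl[\bigl(\lambda^A-\tfrac{\partial h}{\partial\pi^\nu_A}dx^\nu\bigr)\wedge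 d^nx_\mu\bigr]=0;$$ (iii) the energy balance of (ii) holds and, along $s$, for all $A$, $$\partial_\mu\pi^\mu_A-(\mathrm{ad}^*_{\partial h/\partial\pi^\mu}\pi^\mu)_A+T^B_A\tfrac{\partial h}{\partial y^B}=0,\qquad s^*\lambda^A=\tfrac{\partial h}{\partial\pi^\nu_A}dx^\nu ;$$ (iv) along $s$, $Dh(X_\mu)=0$ for all $\mu$, $\tau^\mu_A(X_\mu)=0$ (summed over $\mu$) for all $A$, and $\vartheta^A_h(X_\mu)=0$ for all $A,\mu$, where $Dh=dh-\frac{\partial h}{\partial x^\alpha}dx^\alpha-\psi^\mu(X_\mu,X_\alpha)\,dx^\alpha$, $\tau^\mu_A=d\pi^\mu_A-(\mathrm{ad}^*_\lambda\pi^\mu)_A+\frac1{n+1}T^B_A\frac{\partial h}{\partial y^B}dx^\mu$ and $\vartheta_h^A=\lambda^A-\frac{\partial h}{\partial\pi^\nu_A}dx^\nu$; (v) $\mathbf X\lrcorner\,\Omega_h^*=(-1)^nDh$ along $s$, where $\mathbf X\lrcorner\,\Omega^*_h=\Omega^*_h(X_1,\dots,X_{n+1},\cdot)$. (3) The last equation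 of (iii) is the inverse Legendre relation: if $\mathbb F l$ is a fibre diffeomorphism $J^1E\to J^1E^*$ over the coordinate domain, then for every section $s$ as in (2), $s^*\lambda^A=\frac{\partial h}{\partial\pi^\nu_A}dx^\nu$ holds for all $A$ if and only if $s=\mathbb F l\circ j^1g$. -/

import Mathlib

open scoped Manifold ContDiff

noncomputable section

namespace DeDonderWeylPoincare

/-! ### Exterior forms on a vector space

An exterior form on a finite-dimensional real vector space `V` is an element of the exterior
algebra of the dual space; the wedge product is the product of this algebra. -/

section Algebra

variable {V V' : Type*} [AddCommGroup V] [Module ℝ V] [AddCommGroup V'] [Module ℝ V']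

/-- Exterior forms on `V`. -/
abbrev ExtForm (V : Type*) [AddCommGroup V] [Module ℝ V] : Type _ :=
  ExteriorAlgebra ℝ (Module.Dual ℝ V)

/-- A covector as a form of degree one. -/
abbrev oneForm (α : Module.Dual ℝ V) : ExtForm V := ExteriorAlgebra.ι ℝ α

/-- The interior product `v ⌟ a`: the antiderivation with `v ⌟ α = α v` on covectors, i.e.
insertion of `v` into the first slot. -/
def contract (v : V) : ExtForm V →ₗ[ℝ] ExtForm V :=
  CliffordAlgebra.contractLeft (Module.Dual.eval ℝ V v)

/-- `X ⌟ a = a (X₀, …, X_{k-1}, ·, …, ·)` for a tuple of vectors `X`. -/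
def multiContract {k : ℕ} (X : Fin k → V) (a : ExtForm V) : ExtForm V :=
  (List.ofFn X).foldl (fun c v => contract v c) a

/-- The value `a (X₀, …, X_{k-1})` of a form of degree `k`. -/
def evalForm {k : ℕ} (a : ExtForm V) (X : Fin k → V) : ℝ :=
  ExteriorAlgebra.algebraMapInv (multiContract X a)

/-- Pullback of forms along a linear map. -/
def pullForm (f : V →ₗ[ℝ] V') : ExtForm V' →ₐ[ℝ] ExtForm V :=
  ExteriorAlgebra.map f.dualMap

end Algebra

/-! ### Adapted coordinates

Over a coordinate domain of the base the principal bundle is `U × G`. Velocities `ξ^A_μ` and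
multimomenta `π^μ_A` are components with respect to a basis of the Lie algebra. -/

/-- The coordinates `(x^μ)`, `μ = 1, …, n + 1`. -/
abbrev Base (n : ℕ) : Type := Fin (n + 1) → ℝ

/-- Arrays `(ξ^A_μ)` or `(π^μ_A)`; the first index is `μ`, the second one is `A`. -/
abbrev Comp (n N : ℕ) : Type := Fin (n + 1) → Fin N → ℝ

/-- Points `(x, g, ξ)` of `J¹E`, respectively `(x, g, π)` of the dual bundle `J¹E*`. -/
abbrev Jet (n N : ℕ) (G : Type*) : Type _ := Base n × G × Comp n N

/-- The model of `J¹E` and of `J¹E*` as manifolds. -/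
abbrev jetModel (n N : ℕ) : ModelWithCorners ℝ
    (Base n × EuclideanSpace ℝ (Fin N) × Comp n N)
    (ModelProd (Base n) (ModelProd (EuclideanSpace ℝ (Fin N)) (Comp n N))) :=
  𝓘(ℝ, Base n).prod ((𝓡 N).prod 𝓘(ℝ, Comp n N))

variable {n N : ℕ} {G : Type*} [TopologicalSpace G] [ChartedSpace (EuclideanSpace ℝ (Fin N)) G]

/-- The tangent space at a point of `J¹E` or of `J¹E*`. -/
abbrev TJ (p : Jet n N G) : Type _ := TangentSpace (jetModel n N) p

/-- The part of `J¹E` or of `J¹E*` over the domain of the adapted local system `(x^μ, y^A)`. -/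
def coordDomain (U : Set (Base n))
    (y : OpenPartialHomeomorph G (EuclideanSpace ℝ (Fin N))) : Set (Jet n N G) :=
  {p | p.1 ∈ U ∧ p.2.1 ∈ y.source}

/-- The differential of a function. -/
def dFun (f : Jet n N G → ℝ) (p : Jet n N G) : Module.Dual ℝ (TJ p) :=
  (mfderiv (jetModel n N) 𝓘(ℝ, ℝ) f p : TJ p →L[ℝ] ℝ).toLinearMap

/-- `dx^μ`. -/
def dx (μ : Fin (n + 1)) (p : Jet n N G) : Module.Dual ℝ (TJ p) := dFun (fun q => q.1 μ) p

/-- `dπ^μ_A`. -/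
def dmom (μ : Fin (n + 1)) (A : Fin N) (p : Jet n N G) : Module.Dual ℝ (TJ p) :=
  dFun (fun q => q.2.2 μ A) p

/-- The coordinate vector `∂/∂x^μ`. -/
def basex (μ : Fin (n + 1)) (p : Jet n N G) : TJ p :=
  ((Pi.single μ 1, 0, 0) : Base n × EuclideanSpace ℝ (Fin N) × Comp n N)

/-- `ω = dx¹ ∧ … ∧ dx^{n+1}`. -/
def vol (p : Jet n N G) : ExtForm (TJ p) := (List.ofFn fun μ => oneForm (dx μ p)).prod

/-- `dⁿx_μ = ∂_μ ⌟ ω`. -/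
def dnx (μ : Fin (n + 1)) (p : Jet n N G) : ExtForm (TJ p) := contract (basex μ p) (vol p)

/-- `dⁿ⁻¹x_{μν} = ∂_ν ⌟ dⁿx_μ`. -/
def dn1x (μ ν : Fin (n + 1)) (p : Jet n N G) : ExtForm (TJ p) :=
  contract (basex ν p) (dnx μ p)

/-! ### Partial derivatives -/

/-- `∂f/∂x^ν`. -/
def partialX (f : Jet n N G → ℝ) (ν : Fin (n + 1)) (p : Jet n N G) : ℝ :=
  fderiv ℝ (fun x => f (x, p.2.1, p.2.2)) p.1 (Pi.single ν 1)

/-- `∂f/∂y^B` in the local coordinates `y` of the fibre. -/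
def partialY (y : OpenPartialHomeomorph G (EuclideanSpace ℝ (Fin N))) (f : Jet n N G → ℝ)
    (B : Fin N) (p : Jet n N G) : ℝ :=
  fderiv ℝ (fun z => f (p.1, y.symm z, p.2.2)) (y p.2.1) (EuclideanSpace.single B 1)

/-- `∂f/∂ξ^A_μ` on `J¹E`, respectively `∂f/∂π^μ_A` on `J¹E*`. -/
def partialC (f : Jet n N G → ℝ) (μ : Fin (n + 1)) (A : Fin N) (p : Jet n N G) : ℝ :=
  fderiv ℝ (fun c => f (p.1, p.2.1, c)) p.2.2 (Pi.single μ (Pi.single A 1))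

variable [Group G] (b : Module.Basis (Fin N) ℝ (GroupLieAlgebra (𝓡 N) G))

/-! ### Lie group data -/

/-- The element `ξ^A e_A` of the Lie algebra. -/
def lieVec (ξ : Fin N → ℝ) : GroupLieAlgebra (𝓡 N) G := ∑ A, ξ A • b A

/-- Structure constants: `[e_B, e_C] = c^A_{BC} e_A`. -/
def structConst (A B C : Fin N) : ℝ := b.coord A ⁅b B, b C⁆

/-- The components of the coadjoint action: `⟨ad*_ξ π, β⟩ = ⟨π, [ξ, β]⟩`. -/
def coad (ξ : GroupLieAlgebra (𝓡 N) G) (π : Fin N → ℝ) (A : Fin N) : ℝ :=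
  ∑ C, π C * b.coord C ⁅ξ, b A⁆

/-- The component `λ^A` of the left-invariant Maurer-Cartan form `g ↦ T_g L_{g⁻¹}` of `G`. -/
def maurerCartan (A : Fin N) (g : G) : Module.Dual ℝ (TangentSpace (𝓡 N) g) :=
  (b.coord A).comp
    (mfderiv (𝓡 N) (𝓡 N) (fun a : G => g⁻¹ * a) g :
      TangentSpace (𝓡 N) g →L[ℝ] GroupLieAlgebra (𝓡 N) G).toLinearMap

/-- `λ^A` as a covector on `J¹E` or `J¹E*`. -/
def lam (A : Fin N) (p : Jet n N G) : Module.Dual ℝ (TJ p) :=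
  (maurerCartan b A p.2.1).comp
    (mfderiv (jetModel n N) (𝓡 N) (fun q : Jet n N G => q.2.1) p :
      TJ p →L[ℝ] TangentSpace (𝓡 N) p.2.1).toLinearMap

/-- The form `[λ, λ]^A`, where `[λ, λ] (X, Y) = [λ X, λ Y]`. -/
def lamBracket (A : Fin N) (p : Jet n N G) : ExtForm (TJ p) :=
  (1 / 2 : ℝ) • ∑ B, ∑ C, structConst b A B C • (oneForm (lam b B p) * oneForm (lam b C p))

/-- `(ad*_λ π^μ)_A` as a covector on `J¹E*`. -/
def coadLam (μ : Fin (n + 1)) (A : Fin N) (p : Jet n N G) : Module.Dual ℝ (TJ p) :=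
  ∑ B, coad b (b B) (p.2.2 μ) A • lam b B p

/-- `T^B_A = dy^B (ẽ_A)` where `ẽ_A` is the left-invariant field with `ẽ_A (1) = e_A`. -/
def changeBasis (y : OpenPartialHomeomorph G (EuclideanSpace ℝ (Fin N))) (B A : Fin N) (g : G) :
    ℝ :=
  (mfderiv (𝓡 N) 𝓘(ℝ, ℝ) (fun a => y a B) g : TangentSpace (𝓡 N) g →L[ℝ] ℝ)
    (mulInvariantVectorField (b A) g)

/-- `T^B_A ∂f/∂y^B`. -/
def fibreTerm (y : OpenPartialHomeomorph G (EuclideanSpace ℝ (Fin N))) (f : Jet n N G → ℝ)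
    (A : Fin N) (p : Jet n N G) : ℝ :=
  ∑ B, changeBasis b y B A p.2.1 * partialY y f B p

/-! ### Legendre transformation and Lagrangian forms -/

/-- The reduced covariant Legendre transformation `(x, g, ξ) ↦ (x, g, ∂l/∂ξ)`. -/
def legendre (l : Jet n N G → ℝ) (q : Jet n N G) : Jet n N G :=
  (q.1, q.2.1, fun μ A => partialC l μ A q)

/-- `(∂l/∂ξ^A_μ) ξ^A_μ - l`. -/
def energy (l : Jet n N G → ℝ) (q : Jet n N G) : ℝ :=
  ∑ μ, ∑ A, partialC l μ A q * q.2.2 μ A - l q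

/-- The tangent map of the Legendre transformation. -/
def tangentLegendre (l : Jet n N G → ℝ) (q : Jet n N G) : TJ q →ₗ[ℝ] TJ (legendre l q) :=
  (mfderiv (jetModel n N) (jetModel n N) (legendre l) q :
    TJ q →L[ℝ] TJ (legendre l q)).toLinearMap

/-- The Legendre transformation of `l` is a fibre diffeomorphism over the domain `D`. -/
def IsHyperregular (l : Jet n N G → ℝ) (D : Set (Jet n N G)) : Prop :=
  ∃ K : Jet n N G → Jet n N G, ContMDiffOn (jetModel n N) (jetModel n N) ∞ K D ∧
    (∀ q ∈ D, K (legendre l q) = q) ∧ ∀ p ∈ D, legendre l (K p) = p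

/-- `Θ_ℓ = (∂l/∂ξ^A_μ) λ^A ∧ dⁿx_μ - ((∂l/∂ξ^A_μ) ξ^A_μ - l) ω`. -/
def thetaLag (l : Jet n N G → ℝ) (q : Jet n N G) : ExtForm (TJ q) :=
  ∑ μ, (∑ A, partialC l μ A q • oneForm (lam b A q)) * dnx μ q - energy l q • vol q

/-- `Ω_ℓ = (λ^A ∧ d(∂l/∂ξ^A_μ) + (∂l/∂ξ^A_μ) [λ, λ]^A) ∧ dⁿx_μ
  + (ξ^A_μ d(∂l/∂ξ^A_μ) - T^B_A (∂l/∂y^B) λ^A) ∧ ω`. -/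
def omegaLag (y : OpenPartialHomeomorph G (EuclideanSpace ℝ (Fin N))) (l : Jet n N G → ℝ)
    (q : Jet n N G) : ExtForm (TJ q) :=
  ∑ μ, (∑ A, (oneForm (lam b A q) * oneForm (dFun (partialC l μ A) q)
      + partialC l μ A q • lamBracket b A q)) * dnx μ q
    + (∑ μ, ∑ A, q.2.2 μ A • oneForm (dFun (partialC l μ A) q)
      - ∑ A, fibreTerm b y l A q • oneForm (lam b A q)) * vol q

/-! ### Hamiltonian forms -/

/-- `ψ^μ = λ^A ∧ dπ^μ_A + π^μ_A [λ, λ]^A`. -/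
def psi (μ : Fin (n + 1)) (p : Jet n N G) : ExtForm (TJ p) :=
  ∑ A, (oneForm (lam b A p) * oneForm (dmom μ A p) + p.2.2 μ A • lamBracket b A p)

/-- `Θ_h = π^μ_A λ^A ∧ dⁿx_μ - h ω`. -/
def thetaHam (h : Jet n N G → ℝ) (p : Jet n N G) : ExtForm (TJ p) :=
  ∑ μ, (∑ A, p.2.2 μ A • oneForm (lam b A p)) * dnx μ p - h p • vol p

/-- The canonical form `Ω_h^* = ψ^μ ∧ dⁿx_μ`. -/
def omegaStar (p : Jet n N G) : ExtForm (TJ p) := ∑ μ, psi b μ p * dnx μ p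

/-- `Ω_h = (λ^A ∧ dπ^μ_A + π^μ_A [λ, λ]^A) ∧ dⁿx_μ + dh ∧ ω`. -/
def omegaHam (h : Jet n N G → ℝ) (p : Jet n N G) : ExtForm (TJ p) :=
  omegaStar b p + oneForm (dFun h p) * vol p

/-! ### Sections of `J¹E*` -/

/-- The section `x ↦ (x, g x, π x)`. -/
def sec (g : Base n → G) (ϖ : Base n → Comp n N) (x : Base n) : Jet n N G := (x, g x, ϖ x)

/-- The tangent map of a section at `x`. -/
def tangentSec (g : Base n → G) (ϖ : Base n → Comp n N) (x : Base n) :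
    Base n →ₗ[ℝ] TJ (sec g ϖ x) :=
  (mfderiv 𝓘(ℝ, Base n) (jetModel n N) (sec g ϖ) x : Base n →L[ℝ] TJ (sec g ϖ x)).toLinearMap

/-- The pullback of forms at `x` by a section. -/
def pullSec (g : Base n → G) (ϖ : Base n → Comp n N) (x : Base n) :
    ExtForm (TJ (sec g ϖ x)) →ₐ[ℝ] ExtForm (Base n) :=
  pullForm (tangentSec g ϖ x)

/-- The multivector `(X_1, …, X_{n+1})`, `X_μ = Tψ (∂_μ)`, tangent to a section. -/
def tangentFrame (g : Base n → G) (ϖ : Base n → Comp n N) (x : Base n) (μ : Fin (n + 1)) :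
    TJ (sec g ϖ x) :=
  tangentSec g ϖ x (Pi.single μ 1)

/-- The first jet prolongation `(x, g x, ξ x)`, `ξ^A_μ = λ^A (∂g/∂x^μ)`. -/
def jetProlong (g : Base n → G) (x : Base n) : Jet n N G :=
  (x, g x, fun μ A => maurerCartan b A (g x)
    ((mfderiv 𝓘(ℝ, Base n) (𝓡 N) g x : Base n →L[ℝ] TangentSpace (𝓡 N) (g x))
      (Pi.single μ 1)))

/-- Hamiltonian sections over `U`: the pullback of `W ⌟ Ω_h` vanishes for every smooth vector
field `W` on the domain `D` in `J¹E*`. -/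
def IsHamiltonianSection [IsManifold (𝓡 N) 1 G] (h : Jet n N G → ℝ) (U : Set (Base n))
    (D : Set (Jet n N G)) (g : Base n → G) (ϖ : Base n → Comp n N) : Prop :=
  ∀ W : (p : Jet n N G) → TJ p,
    ContMDiffOn (jetModel n N) (jetModel n N).tangent ∞
      (fun p => (⟨p, W p⟩ : TangentBundle (jetModel n N) (Jet n N G))) D →
    ∀ x ∈ U, pullSec g ϖ x (contract (W (sec g ϖ x)) (omegaHam b h (sec g ϖ x))) = 0

/-- `τ^μ_A = dπ^μ_A - (ad*_λ π^μ)_A + (1/(n+1)) T^B_A (∂h/∂y^B) dx^μ`. -/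
def tau (y : OpenPartialHomeomorph G (EuclideanSpace ℝ (Fin N))) (h : Jet n N G → ℝ)
    (μ : Fin (n + 1)) (A : Fin N) (p : Jet n N G) : Module.Dual ℝ (TJ p) :=
  dmom μ A p - coadLam b μ A p + (1 / ((n : ℝ) + 1) * fibreTerm b y h A p) • dx μ p

/-- The Hamiltonian contact form `ϑ_h^A = λ^A - (∂h/∂π^ν_A) dx^ν`. -/
def contactHam (h : Jet n N G → ℝ) (A : Fin N) (p : Jet n N G) : Module.Dual ℝ (TJ p) :=
  lam b A p - ∑ ν, partialC h ν A p • dx ν p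

/-- The energy balance
`ψ^* [dh ∧ dⁿx_ν - (∂h/∂x^ν) ω - ψ^μ ∧ dⁿ⁻¹x_{μν}] = 0` for all `ν`. -/
def EnergyBalance (h : Jet n N G → ℝ) (U : Set (Base n)) (g : Base n → G)
    (ϖ : Base n → Comp n N) : Prop :=
  ∀ x ∈ U, ∀ ν, pullSec g ϖ x
    (oneForm (dFun h (sec g ϖ x)) * dnx ν (sec g ϖ x)
      - partialX h ν (sec g ϖ x) • vol (sec g ϖ x)
      - ∑ μ, psi b μ (sec g ϖ x) * dn1x μ ν (sec g ϖ x)) = 0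

/-- `ψ^* [τ^μ_A ∧ dⁿx_μ] = 0` (summed over `μ`) for all `A`. -/
def MomentumForm (y : OpenPartialHomeomorph G (EuclideanSpace ℝ (Fin N))) (h : Jet n N G → ℝ)
    (U : Set (Base n)) (g : Base n → G) (ϖ : Base n → Comp n N) : Prop :=
  ∀ x ∈ U, ∀ A, pullSec g ϖ x
    (∑ μ, oneForm (tau b y h μ A (sec g ϖ x)) * dnx μ (sec g ϖ x)) = 0

/-- `ψ^* [ϑ_h^A ∧ dⁿx_μ] = 0` for all `A` and `μ`. -/
def ContactForm (h : Jet n N G → ℝ) (U : Set (Base n)) (g : Base n → G)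
    (ϖ : Base n → Comp n N) : Prop :=
  ∀ x ∈ U, ∀ A μ, pullSec g ϖ x
    (oneForm (contactHam b h A (sec g ϖ x)) * dnx μ (sec g ϖ x)) = 0

/-- `∂π^μ_A/∂x^μ - (ad*_{∂h/∂π^μ} π^μ)_A + T^B_A ∂h/∂y^B = 0` along the section. -/
def MomentumEquation (y : OpenPartialHomeomorph G (EuclideanSpace ℝ (Fin N)))
    (h : Jet n N G → ℝ) (U : Set (Base n)) (g : Base n → G) (ϖ : Base n → Comp n N) : Prop :=
  ∀ x ∈ U, ∀ A,
    ∑ μ, fderiv ℝ (fun x' => ϖ x' μ A) x (Pi.single μ 1)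
      - ∑ μ, coad b (lieVec b fun B => partialC h μ B (sec g ϖ x)) (ϖ x μ) A
      + fibreTerm b y h A (sec g ϖ x) = 0

/-- `λ^A = (∂h/∂π^ν_A) dx^ν` along the section, as 1-forms on the base. -/
def InverseLegendre (h : Jet n N G → ℝ) (U : Set (Base n)) (g : Base n → G)
    (ϖ : Base n → Comp n N) : Prop :=
  ∀ x ∈ U, ∀ A, (lam b A (sec g ϖ x)).comp (tangentSec g ϖ x)
    = ∑ ν, partialC h ν A (sec g ϖ x) • (LinearMap.proj ν : Base n →ₗ[ℝ] ℝ)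

/-- `Dh = dh - (∂h/∂x^α) dx^α - ψ^μ (X_μ, X_α) dx^α`. -/
def Dh (h : Jet n N G → ℝ) (g : Base n → G) (ϖ : Base n → Comp n N) (x : Base n) :
    Module.Dual ℝ (TJ (sec g ϖ x)) :=
  dFun h (sec g ϖ x) - ∑ α, partialX h α (sec g ϖ x) • dx α (sec g ϖ x)
    - ∑ α, (∑ μ, evalForm (psi b μ (sec g ϖ x))
        ![tangentFrame g ϖ x μ, tangentFrame g ϖ x α]) • dx α (sec g ϖ x)

end DeDonderWeylPoincare

end

open DeDonderWeylPoincare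

noncomputable section

set_option linter.unusedSectionVars false

namespace DeDonderWeylPoincare

/-! ### Exterior calculus on a vector space: contraction, pullback, degree -/

section Forms

variable {V V' : Type*} [AddCommGroup V] [Module ℝ V] [AddCommGroup V'] [Module ℝ V']

/-! Apart from differentiability, the equivalences are linear algebra at one point. Let S = Ts at x
and let P be the differential of the projection to the base, so that P ∘ S = id. The forms ω, dⁿx_μ,
dⁿ⁻¹x_{μν} are pullbacks along P; hence S pulls them back to the coordinate forms of the base, where
products of degree n + 2 vanish. Since each ψ^μ has degree two, contraction acts on it as a
derivation, and s^*(W ⌟ Ω_h) is an explicit multiple of the volume form (`pullForm_contract_omega`,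
`pullForm_contract_oneForm_mul_vol`).

Expanding dh in the coframe dx, λ, dπ (`dFun_apply`) and evaluating ψ^μ (`eval2_psi`) turns the
coefficient into λ^A(W) τ^μ_A(X_μ) − ϑ_h^A(X_μ) dπ^μ_A(W) − dx^ν(W) Dh(X_ν)
(`pullSec_contract_omegaHam`). The values of dx, λ, dπ on W can be prescribed freely by smooth
fields, so vanishing for all W is (iv). The forms in (ii) are multiples of the volume form with
these same coefficients. Inserting ϑ_h^A(X_μ) = 0 into the momentum equation gives (iii).

For (v), evaluating X ⌟ Ω_h^* − (−1)ⁿ Dh on W leaves, up to sign, only the first two terms above.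
The equations Dh(X_ν) = 0 then come for free, because Ω_h^* is alternating
(`Dh_tangentFrame_eq_zero`).

The pullback formulas follow from d(h ∘ Fl) = d(energy), where the terms (∂l/∂ξ) dξ cancel and the
dx terms are killed by ω. The inverse Legendre relation is the classical computation on a fibre: if
k inverts ∂l/∂ξ, then h(c) = c · k(c) − l(k(c)) has gradient k(c). -/

theorem contract_oneForm_mul (v : V) (α : Module.Dual ℝ V) (a : ExtForm V) :
    contract v (oneForm α * a) = α v • a - oneForm α * contract v a :=
  CliffordAlgebra.contractLeft_ι_mul _ α a

theorem contract_oneForm (v : V) (α : Module.Dual ℝ V) :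
    contract v (oneForm α) = algebraMap ℝ _ (α v) :=
  CliffordAlgebra.contractLeft_ι _ _ α

theorem contract_algebraMap (v : V) (r : ℝ) :
    contract v (algebraMap ℝ (ExtForm V) r) = 0 :=
  CliffordAlgebra.contractLeft_algebraMap _ _ r

theorem contract_one (v : V) : contract v (1 : ExtForm V) = 0 :=
  CliffordAlgebra.contractLeft_one _ _

theorem contract_contract_comm (v w : V) (a : ExtForm V) :
    contract v (contract w a) = -contract w (contract v a) :=
  CliffordAlgebra.contractLeft_comm _ _ a

theorem oneForm_sub (α β : Module.Dual ℝ V) : oneForm (α - β) = oneForm α - oneForm β :=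
  map_sub _ _ _

theorem oneForm_smul (r : ℝ) (α : Module.Dual ℝ V) : oneForm (r • α) = r • oneForm α :=
  map_smul _ _ _

theorem oneForm_sum {ι : Type*} (s : Finset ι) (α : ι → Module.Dual ℝ V) :
    oneForm (∑ i ∈ s, α i) = ∑ i ∈ s, oneForm (α i) :=
  map_sum _ _ _

/-- The interior product, linear in the vector as well. -/
def contractHom : V →ₗ[ℝ] ExtForm V →ₗ[ℝ] ExtForm V :=
  CliffordAlgebra.contractLeft.comp (Module.Dual.eval ℝ V)

theorem contractHom_apply (v : V) (a : ExtForm V) : contractHom v a = contract v a := rfl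

theorem contract_sum_smul {ι : Type*} (s : Finset ι) (r : ι → ℝ) (v : ι → V) (a : ExtForm V) :
    contract (∑ i ∈ s, r i • v i) a = ∑ i ∈ s, r i • contract (v i) a := by
  simp only [← contractHom_apply, map_sum, map_smul, LinearMap.sum_apply, LinearMap.smul_apply]

@[simp]
theorem pullForm_oneForm (f : V →ₗ[ℝ] V') (α : Module.Dual ℝ V') :
    pullForm f (oneForm α) = oneForm (α.comp f) :=
  ExteriorAlgebra.map_apply_ι _ α

theorem ExtForm.induction {p : ExtForm V → Prop} (h0 : ∀ r, p (algebraMap ℝ _ r))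
    (hadd : ∀ a c, p a → p c → p (a + c)) (hmul : ∀ α a, p a → p (oneForm α * a))
    (a : ExtForm V) : p a :=
  CliffordAlgebra.left_induction (0 : QuadraticForm ℝ (Module.Dual ℝ V)) h0 hadd
    (fun x m hx => hmul m x hx) a

theorem contract_pullForm (f : V →ₗ[ℝ] V') (v : V) (a : ExtForm V') :
    contract v (pullForm f a) = pullForm f (contract (f v) a) := by
  induction a using ExtForm.induction with
  | h0 r => simp [contract_algebraMap]
  | hadd a c ha hc => simp [ha, hc]
  | hmul α a ha =>
    rw [map_mul, pullForm_oneForm, contract_oneForm_mul, contract_oneForm_mul, ha]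
    simp

theorem pullForm_pullForm {V'' : Type*} [AddCommGroup V''] [Module ℝ V''] (f : V →ₗ[ℝ] V')
    (f' : V' →ₗ[ℝ] V'') (a : ExtForm V'') :
    pullForm f (pullForm f' a) = pullForm (f'.comp f) a := by
  induction a using ExtForm.induction with
  | h0 r => simp
  | hadd a c ha hc => simp [ha, hc]
  | hmul α a ha => simp only [map_mul, ha, pullForm_oneForm]; rfl

theorem pullForm_id (a : ExtForm V) : pullForm LinearMap.id a = a := by
  induction a using ExtForm.induction with
  | h0 r => simp
  | hadd a c ha hc => simp [ha, hc]
  | hmul α a ha => simp only [map_mul, ha, pullForm_oneForm]; rfl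

/-- Pullback fixes scalars and sends positive degree to positive degree. Values of forms may thus be
computed before or after pulling back. -/
theorem pullForm_algebraMapInv (f : V →ₗ[ℝ] V') (a : ExtForm V') :
    ExteriorAlgebra.algebraMapInv (pullForm f a) = ExteriorAlgebra.algebraMapInv a := by
  induction a using ExtForm.induction with
  | h0 r => simp
  | hadd a c ha hc => simp [ha, hc]
  | hmul α a ha => simp [map_mul, ExteriorAlgebra.algebraMapInv]

/-- Exterior forms of degree `k`. -/
abbrev formsOfDegree (V : Type*) [AddCommGroup V] [Module ℝ V] (k : ℕ) :
    Submodule ℝ (ExtForm V) :=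
  LinearMap.range (ExteriorAlgebra.ι ℝ : Module.Dual ℝ V →ₗ[ℝ] ExtForm V) ^ k

theorem oneForm_mem (α : Module.Dual ℝ V) : oneForm α ∈ formsOfDegree V 1 := by
  rw [formsOfDegree, pow_one]; exact ⟨α, rfl⟩

theorem mul_mem_formsOfDegree {j k : ℕ} {a c : ExtForm V} (ha : a ∈ formsOfDegree V j)
    (hc : c ∈ formsOfDegree V k) : a * c ∈ formsOfDegree V (j + k) := by
  rw [formsOfDegree, pow_add]; exact Submodule.mul_mem_mul ha hc

theorem contract_mem_formsOfDegree {k : ℕ} (v : V) {a : ExtForm V}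
    (ha : a ∈ formsOfDegree V (k + 1)) : contract v a ∈ formsOfDegree V k := by
  induction k generalizing a with
  | zero =>
    rw [formsOfDegree, zero_add, pow_one] at ha
    obtain ⟨α, rfl⟩ := ha
    rw [contract_oneForm, formsOfDegree, pow_zero]
    exact Submodule.algebraMap_mem _
  | succ k ih =>
    rw [formsOfDegree, pow_succ'] at ha
    induction ha using Submodule.mul_induction_on' with
    | mem_mul_mem m hm c hc =>
      obtain ⟨α, rfl⟩ := hm
      have := contract_oneForm_mul v α c
      rw [this]
      refine Submodule.sub_mem _ (Submodule.smul_mem _ _ hc) ?_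
      have := mul_mem_formsOfDegree (oneForm_mem α) (ih hc)
      rwa [add_comm] at this
    | add c _ d _ hc hd => rw [map_add]; exact Submodule.add_mem _ hc hd

theorem prod_oneForm_mem {k : ℕ} (α : Fin k → Module.Dual ℝ V) :
    (List.ofFn fun i => oneForm (α i)).prod ∈ formsOfDegree V k := by
  induction k with
  | zero => simp [formsOfDegree]
  | succ k ih =>
    rw [List.ofFn_succ, List.prod_cons]
    have := mul_mem_formsOfDegree (oneForm_mem (α 0)) (ih fun i => α i.succ)
    rwa [add_comm 1 k] at this

theorem pullForm_mem_formsOfDegree {k : ℕ} (f : V →ₗ[ℝ] V') {a : ExtForm V'}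
    (ha : a ∈ formsOfDegree V' k) : pullForm f a ∈ formsOfDegree V k := by
  induction k generalizing a with
  | zero =>
    rw [formsOfDegree, pow_zero] at ha ⊢
    obtain ⟨r, rfl⟩ := Submodule.mem_one.mp ha
    rw [AlgHom.commutes]
    exact Submodule.algebraMap_mem _
  | succ k ih =>
    rw [formsOfDegree, pow_succ'] at ha
    induction ha using Submodule.mul_induction_on' with
    | mem_mul_mem m hm c hc =>
      obtain ⟨α, rfl⟩ := hm
      rw [map_mul, add_comm]
      refine mul_mem_formsOfDegree ?_ (ih hc)
      rw [pullForm_oneForm]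
      exact oneForm_mem _
    | add c _ d _ hc hd => rw [map_add]; exact Submodule.add_mem _ hc hd

theorem multiContract_succ {k : ℕ} (X : Fin (k + 1) → V) (a : ExtForm V) :
    multiContract X a = multiContract (fun i => X i.succ) (contract (X 0) a) := by
  simp [multiContract, List.ofFn_succ]

theorem multiContract_mem_formsOfDegree {k j : ℕ} (X : Fin k → V) {a : ExtForm V}
    (ha : a ∈ formsOfDegree V (j + k)) : multiContract X a ∈ formsOfDegree V j := by
  induction k generalizing a with
  | zero => simpa [multiContract] using ha
  | succ k ih =>
    rw [multiContract_succ]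
    exact ih _ (contract_mem_formsOfDegree _ ha)

theorem multiContract_smul {k : ℕ} (X : Fin k → V) (r : ℝ) (a : ExtForm V) :
    multiContract X (r • a) = r • multiContract X a := by
  induction k generalizing a with
  | zero => simp [multiContract]
  | succ k ih => simp [multiContract_succ, ih]

/-- Insertions anticommute, so moving `v` past the `k` vectors costs one sign for each. -/
theorem contract_multiContract {k : ℕ} (v : V) (X : Fin k → V) (a : ExtForm V) :
    contract v (multiContract X a) = (-1 : ℝ) ^ k • multiContract X (contract v a) := by
  induction k generalizing a with
  | zero => simp [multiContract]
  | succ k ih =>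
    rw [multiContract_succ, multiContract_succ, ih, contract_contract_comm,
      ← neg_one_smul ℝ (contract _ _), multiContract_smul, smul_smul, pow_succ]

theorem multiContract_pullForm {k : ℕ} (f : V →ₗ[ℝ] V') (X : Fin k → V) (a : ExtForm V') :
    multiContract X (pullForm f a) = pullForm f (multiContract (fun i => f (X i)) a) := by
  induction k generalizing a with
  | zero => simp [multiContract]
  | succ k ih => rw [multiContract_succ, multiContract_succ, contract_pullForm, ih]

/-- By duality the first vector pairs only with the first factor and annihilates all the others; the
rest is induction. -/
theorem multiContract_prod {k : ℕ} (X : Fin k → V) (α : Fin k → Module.Dual ℝ V)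
    (h : ∀ i j, α i (X j) = if i = j then 1 else 0) :
    multiContract X (List.ofFn fun i => oneForm (α i)).prod = 1 := by
  induction k with
  | zero => simp [multiContract]
  | succ k ih =>
    have key : ∀ (m : ℕ) (β : Fin m → Module.Dual ℝ V), (∀ i, β i (X 0) = 0) →
        contract (X 0) (List.ofFn fun i => oneForm (β i)).prod = 0 := by
      intro m
      induction m with
      | zero => intro β _; simp [contract_one]
      | succ m ihm =>
        intro β hβ
        rw [List.ofFn_succ, List.prod_cons, contract_oneForm_mul, hβ, ihm _ fun i => hβ _]
        simp
    rw [multiContract_succ, List.ofFn_succ, List.prod_cons, contract_oneForm_mul, h,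
      key k _ fun i => by rw [h]; simp]
    simp only [if_true, one_smul, mul_zero, sub_zero]
    exact ih _ _ fun i j => by rw [h]; simp

/-- Values of forms of degree two. -/
def eval2 (a : ExtForm V) (v w : V) : ℝ := evalForm a ![v, w]

theorem eval2_eq (a : ExtForm V) (v w : V) :
    eval2 a v w = ExteriorAlgebra.algebraMapInv (contract w (contract v a)) := by
  simp [eval2, evalForm, multiContract]

theorem eval2_add (a c : ExtForm V) (v w : V) :
    eval2 (a + c) v w = eval2 a v w + eval2 c v w := by
  simp [eval2_eq]

theorem eval2_smul (r : ℝ) (a : ExtForm V) (v w : V) :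
    eval2 (r • a) v w = r * eval2 a v w := by
  simp [eval2_eq]

theorem eval2_sum {ι : Type*} (s : Finset ι) (a : ι → ExtForm V) (v w : V) :
    eval2 (∑ i ∈ s, a i) v w = ∑ i ∈ s, eval2 (a i) v w := by
  simp [eval2_eq]

theorem contract_oneForm_mul_oneForm (v : V) (α β : Module.Dual ℝ V) :
    contract v (oneForm α * oneForm β) = oneForm (α v • β - β v • α) := by
  rw [contract_oneForm_mul, contract_oneForm, Algebra.algebraMap_eq_smul_one, mul_smul_comm,
    mul_one, oneForm_sub, oneForm_smul, oneForm_smul]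

theorem eval2_mul (α β : Module.Dual ℝ V) (v w : V) :
    eval2 (oneForm α * oneForm β) v w = α v * β w - α w * β v := by
  rw [eval2_eq, contract_oneForm_mul_oneForm, contract_oneForm,
    ExteriorAlgebra.algebraMap_leftInverse]
  simp [mul_comm]

theorem formsOfDegree_two_induction {p : ExtForm V → Prop}
    (hadd : ∀ a c, p a → p c → p (a + c)) (hmul : ∀ α β, p (oneForm α * oneForm β))
    {a : ExtForm V} (ha : a ∈ formsOfDegree V 2) : p a := by
  rw [formsOfDegree, pow_two] at ha
  induction ha using Submodule.mul_induction_on' with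
  | mem_mul_mem m hm c hc =>
    obtain ⟨α, rfl⟩ := hm
    obtain ⟨β, rfl⟩ := hc
    exact hmul α β
  | add c _ d _ hc hd => exact hadd _ _ hc hd

/-- For a form of degree two, contraction is a derivation. -/
theorem contract_mul_of_degree_two {ψ : ExtForm V} (hψ : ψ ∈ formsOfDegree V 2) (v : V)
    (c : ExtForm V) : contract v (ψ * c) = contract v ψ * c + ψ * contract v c := by
  refine formsOfDegree_two_induction
    (p := fun ψ => contract v (ψ * c) = contract v ψ * c + ψ * contract v c)
    (fun a d ha hd => ?_) (fun α β => ?_) hψ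
  · rw [add_mul, map_add, ha, hd, map_add]; noncomm_ring
  · rw [contract_oneForm_mul_oneForm, mul_assoc, contract_oneForm_mul, contract_oneForm_mul,
      oneForm_sub, oneForm_smul, oneForm_smul]
    simp only [mul_sub, sub_mul, smul_mul_assoc, mul_smul_comm, mul_assoc]
    abel

theorem exists_oneForm {a : ExtForm V} (ha : a ∈ formsOfDegree V 1) : ∃ α, a = oneForm α := by
  rw [formsOfDegree, pow_one] at ha
  obtain ⟨α, rfl⟩ := ha
  exact ⟨α, rfl⟩

/-- Names the covector `ψ(v, ·)`, so that products with `contract v ψ` fall under the rules for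
one-forms. -/
theorem exists_contract_eq {ψ : ExtForm V} (hψ : ψ ∈ formsOfDegree V 2) (v : V) :
    ∃ β : Module.Dual ℝ V, contract v ψ = oneForm β ∧ ∀ w, eval2 ψ v w = β w := by
  obtain ⟨β, hβ⟩ := exists_oneForm (contract_mem_formsOfDegree v hψ)
  refine ⟨β, hβ, fun w => ?_⟩
  rw [eval2_eq, hβ, contract_oneForm, ExteriorAlgebra.algebraMap_leftInverse]

theorem eval2_pullForm (f : V →ₗ[ℝ] V') (a : ExtForm V') (v w : V) :
    eval2 (pullForm f a) v w = eval2 a (f v) (f w) := by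
  rw [eval2_eq, eval2_eq, contract_pullForm, contract_pullForm, pullForm_algebraMapInv]

/-- The degree assumption is essential: contracting once and taking the scalar part sees only the
component of degree one. -/
theorem oneForm_eq_of_contract {a : ExtForm V} (ha : a ∈ formsOfDegree V 1)
    (α : Module.Dual ℝ V) :
    a = oneForm α ↔ ∀ w, ExteriorAlgebra.algebraMapInv (contract w a) = α w := by
  obtain ⟨β, rfl⟩ := exists_oneForm ha
  simp only [contract_oneForm, ExteriorAlgebra.algebraMap_leftInverse _ _]
  rw [ExteriorAlgebra.ι_inj, LinearMap.ext_iff]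

end Forms

/-! ### Forms on the base -/

section BaseForms

variable {n : ℕ}

/-- The volume form of the base. -/
def baseVol (n : ℕ) : ExtForm (Base n) :=
  (List.ofFn fun μ => oneForm (LinearMap.proj μ : Base n →ₗ[ℝ] ℝ)).prod

/-- `∂_μ ⌟ ω` on the base. -/
def baseVol1 (μ : Fin (n + 1)) : ExtForm (Base n) := contract (Pi.single μ 1) (baseVol n)

/-- `∂_ν ⌟ ∂_μ ⌟ ω` on the base. -/
def baseVol2 (μ ν : Fin (n + 1)) : ExtForm (Base n) := contract (Pi.single ν 1) (baseVol1 μ)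

theorem multiContract_baseVol :
    multiContract (fun μ : Fin (n + 1) => (Pi.single μ 1 : Base n)) (baseVol n) = 1 :=
  multiContract_prod _ _ fun i j => by simp [Pi.single_apply]

/-- Inserting all coordinate vectors into the volume form gives 1, which recovers the coefficient.
-/
theorem baseVol_smul_eq_zero {r : ℝ} (h : r • baseVol n = 0) : r = 0 := by
  have := multiContract_smul (fun μ : Fin (n + 1) => (Pi.single μ 1 : Base n)) r (baseVol n)
  rw [h, multiContract_baseVol] at this
  have h0 : multiContract (fun μ : Fin (n + 1) => (Pi.single μ 1 : Base n)) 0 = 0 := by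
    have := multiContract_smul (fun μ : Fin (n + 1) => (Pi.single μ 1 : Base n)) 0 0
    simpa using this
  rw [h0, ← Algebra.algebraMap_eq_smul_one] at this
  have := congrArg ExteriorAlgebra.algebraMapInv this
  rwa [ExteriorAlgebra.algebraMap_leftInverse, map_zero, eq_comm] at this

theorem baseVol_smul_eq_zero_iff {r : ℝ} : r • baseVol n = 0 ↔ r = 0 :=
  ⟨baseVol_smul_eq_zero, fun h => by rw [h, zero_smul]⟩

theorem dual_base_eq_sum (α : Module.Dual ℝ (Base n)) :
    α = ∑ ν, α (Pi.single ν 1) • (LinearMap.proj ν : Base n →ₗ[ℝ] ℝ) := by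
  refine LinearMap.pi_ext' fun ν => LinearMap.ext_ring ?_
  simp [Pi.single_apply]

/-- By linearity `α` may be taken to be some dx^ν, which is then a repeated factor. -/
theorem oneForm_mul_baseVol (α : Module.Dual ℝ (Base n)) : oneForm α * baseVol n = 0 := by
  have key : ∀ ν : Fin (n + 1),
      oneForm (LinearMap.proj ν : Base n →ₗ[ℝ] ℝ) * baseVol n = 0 := by
    intro ν
    have := (ExteriorAlgebra.ιMulti ℝ (M := Module.Dual ℝ (Base n)) (n + 2)).map_eq_zero_of_eq
      (Fin.cons (LinearMap.proj ν) fun μ => (LinearMap.proj μ : Base n →ₗ[ℝ] ℝ))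
      (i := 0) (j := ν.succ) (by simp) (Fin.succ_ne_zero ν).symm
    rw [ExteriorAlgebra.ιMulti_apply, List.ofFn_succ, List.prod_cons] at this
    exact this
  rw [dual_base_eq_sum α, oneForm_sum, Finset.sum_mul]
  refine Finset.sum_eq_zero fun ν _ => ?_
  rw [oneForm_smul, smul_mul_assoc, key, smul_zero]

theorem oneForm_mul_baseVol1 (α : Module.Dual ℝ (Base n)) (μ : Fin (n + 1)) :
    oneForm α * baseVol1 μ = α (Pi.single μ 1) • baseVol n := by
  have := contract_oneForm_mul (Pi.single μ 1) α (baseVol n)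
  rw [oneForm_mul_baseVol, map_zero] at this
  exact (sub_eq_zero.mp this.symm).symm

theorem mul_baseVol1_of_degree_two {ψ : ExtForm (Base n)} (hψ : ψ ∈ formsOfDegree (Base n) 2)
    (μ : Fin (n + 1)) : ψ * baseVol1 μ = 0 := by
  refine formsOfDegree_two_induction (p := fun ψ => ψ * baseVol1 μ = 0)
    (fun a c ha hc => ?_) (fun α β => ?_) hψ
  · rw [add_mul, ha, hc, add_zero]
  · rw [mul_assoc, oneForm_mul_baseVol1, mul_smul_comm, oneForm_mul_baseVol, smul_zero]

/-- Contract the vanishing product ψ ∧ dⁿx_μ with ∂_ν. The minus sign from the Leibniz rule is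
absorbed by exchanging the arguments of ψ. -/
theorem mul_baseVol2_of_degree_two {ψ : ExtForm (Base n)} (hψ : ψ ∈ formsOfDegree (Base n) 2)
    (μ ν : Fin (n + 1)) :
    ψ * baseVol2 μ ν = eval2 ψ (Pi.single μ 1) (Pi.single ν 1) • baseVol n := by
  have h1 := contract_mul_of_degree_two hψ (Pi.single ν 1) (baseVol1 μ)
  obtain ⟨β, hβ, hβ'⟩ := exists_contract_eq hψ (Pi.single ν 1 : Base n)
  rw [mul_baseVol1_of_degree_two hψ, map_zero, hβ, oneForm_mul_baseVol1, ← hβ'] at h1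
  have h2 : eval2 ψ (Pi.single μ 1) (Pi.single ν 1) = -eval2 ψ (Pi.single ν 1) (Pi.single μ 1) := by
    rw [eval2_eq, eval2_eq, contract_contract_comm, map_neg]
  rw [h2, neg_smul]
  exact (neg_eq_of_add_eq_zero_right h1.symm).symm

theorem base_eq_sum (w : Base n) : w = ∑ ν, w ν • (Pi.single ν 1 : Base n) := by
  ext μ; simp [Finset.sum_apply, Pi.single_apply]

theorem contract_baseVol (w : Base n) : contract w (baseVol n) = ∑ ν, w ν • baseVol1 ν := by
  conv_lhs => rw [base_eq_sum w]
  exact contract_sum_smul _ _ _ _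

theorem contract_baseVol1 (w : Base n) (μ : Fin (n + 1)) :
    contract w (baseVol1 μ) = ∑ ν, w ν • baseVol2 μ ν := by
  conv_lhs => rw [base_eq_sum w]
  exact contract_sum_smul _ _ _ _

end BaseForms

/-! ### The canonical form along a section, pointwise -/

section Pointwise

variable {n : ℕ} {V : Type*} [AddCommGroup V] [Module ℝ V] {P : V →ₗ[ℝ] Base n}
  {S : Base n →ₗ[ℝ] V}

theorem pullForm_section (hPS : P.comp S = LinearMap.id) (a : ExtForm (Base n)) :
    pullForm S (pullForm P a) = a := by
  rw [pullForm_pullForm, hPS, pullForm_id]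

theorem pullForm_contract_omega (hPS : P.comp S = LinearMap.id) {ψ : Fin (n + 1) → ExtForm V}
    (hψ : ∀ μ, ψ μ ∈ formsOfDegree V 2) (W : V) :
    pullForm S (contract W (∑ μ, ψ μ * pullForm P (baseVol1 μ)))
      = (∑ μ, eval2 (ψ μ) W (S (Pi.single μ 1))
        + ∑ ν, P W ν * ∑ μ, eval2 (ψ μ) (S (Pi.single μ 1)) (S (Pi.single ν 1))) • baseVol n := by
  have h : ∀ μ, pullForm S (contract W (ψ μ * pullForm P (baseVol1 μ)))
      = (eval2 (ψ μ) W (S (Pi.single μ 1)) + ∑ ν, P W ν *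
        eval2 (ψ μ) (S (Pi.single μ 1)) (S (Pi.single ν 1))) • baseVol n := by
    intro μ
    obtain ⟨β, hβ, hβ'⟩ := exists_contract_eq (hψ μ) W
    rw [contract_mul_of_degree_two (hψ μ), contract_pullForm, contract_baseVol1, hβ, map_add,
      map_mul, map_mul, pullForm_section hPS, pullForm_section hPS, pullForm_oneForm,
      oneForm_mul_baseVol1, Finset.mul_sum, add_smul, Finset.sum_smul, hβ']
    congr 1
    refine Finset.sum_congr rfl fun ν _ => ?_
    rw [mul_smul_comm, mul_baseVol2_of_degree_two (pullForm_mem_formsOfDegree S (hψ μ)),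
      eval2_pullForm, smul_smul]
  rw [map_sum, map_sum, Finset.sum_congr rfl fun μ _ => h μ, ← Finset.sum_smul,
    Finset.sum_add_distrib]
  simp only [Finset.mul_sum]
  rw [Finset.sum_comm (f := fun μ ν => P W ν * _)]

theorem pullForm_contract_oneForm_mul_vol (hPS : P.comp S = LinearMap.id)
    (η : Module.Dual ℝ V) (W : V) :
    pullForm S (contract W (oneForm η * pullForm P (baseVol n)))
      = (η W - ∑ ν, P W ν * η (S (Pi.single ν 1))) • baseVol n := by
  rw [contract_oneForm_mul, map_sub, map_smul, map_mul, contract_pullForm, contract_baseVol,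
    pullForm_section hPS, pullForm_section hPS, pullForm_oneForm, sub_smul, Finset.mul_sum,
    Finset.sum_smul]
  congr 1
  refine Finset.sum_congr rfl fun ν _ => ?_
  rw [mul_smul_comm, oneForm_mul_baseVol1, smul_smul]; rfl

theorem pullForm_omega (hPS : P.comp S = LinearMap.id) {ψ : Fin (n + 1) → ExtForm V}
    (hψ : ∀ μ, ψ μ ∈ formsOfDegree V 2) :
    pullForm S (∑ μ, ψ μ * pullForm P (baseVol1 μ)) = 0 := by
  rw [map_sum]
  refine Finset.sum_eq_zero fun μ _ => ?_
  rw [map_mul, pullForm_section hPS,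
    mul_baseVol1_of_degree_two (pullForm_mem_formsOfDegree S (hψ μ))]

/-- The pullback of the canonical form to the base is zero by degree, hence so is its contraction
with ∂_ν; this is that statement in components. -/
theorem contract_section_omega (hPS : P.comp S = LinearMap.id) {ψ : Fin (n + 1) → ExtForm V}
    (hψ : ∀ μ, ψ μ ∈ formsOfDegree V 2) (ν : Fin (n + 1)) :
    ∑ μ, eval2 (ψ μ) (S (Pi.single ν 1)) (S (Pi.single μ 1))
        + ∑ ν', P (S (Pi.single ν 1)) ν' *
          ∑ μ, eval2 (ψ μ) (S (Pi.single μ 1)) (S (Pi.single ν' 1)) = 0 := by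
  rw [← baseVol_smul_eq_zero_iff, ← pullForm_contract_omega hPS hψ, ← contract_pullForm,
    pullForm_omega hPS hψ, map_zero]

theorem baseVol1_mem (μ : Fin (n + 1)) : baseVol1 μ ∈ formsOfDegree (Base n) n :=
  contract_mem_formsOfDegree _ (prod_oneForm_mem _)

theorem multiContract_omega_eq_iff (hPS : P.comp S = LinearMap.id) {ψ : Fin (n + 1) → ExtForm V}
    (hψ : ∀ μ, ψ μ ∈ formsOfDegree V 2) (η : Module.Dual ℝ V) :
    multiContract (fun μ => S (Pi.single μ 1)) (∑ μ, ψ μ * pullForm P (baseVol1 μ))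
        = oneForm ((-1 : ℝ) ^ n • η) ↔
      ∀ W, ∑ μ, eval2 (ψ μ) W (S (Pi.single μ 1))
        + ∑ ν, P W ν * ∑ μ, eval2 (ψ μ) (S (Pi.single μ 1)) (S (Pi.single ν 1)) + η W = 0 := by
  have hmem : ∑ μ, ψ μ * pullForm P (baseVol1 μ) ∈ formsOfDegree V (1 + (n + 1)) := by
    refine Submodule.sum_mem _ fun μ _ => ?_
    have := mul_mem_formsOfDegree (hψ μ) (pullForm_mem_formsOfDegree P (baseVol1_mem μ))
    -- The degree is 2 + n, so inserting n + 1 vectors leaves a one-form.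
    rwa [show 2 + n = 1 + (n + 1) by ring] at this
  rw [oneForm_eq_of_contract (multiContract_mem_formsOfDegree _ hmem)]
  refine forall_congr' fun W => ?_
  -- The value on `W` is found by moving `W` to the first slot, at the cost of (−1)^(n+1), and
  -- evaluating the remaining top-degree form on the base. Against (−1)ⁿ this leaves the relative
  -- minus sign that puts `η W` on the left.
  rw [contract_multiContract, map_smul, ← pullForm_algebraMapInv S, ← multiContract_pullForm,
    pullForm_contract_omega hPS hψ, multiContract_smul, multiContract_baseVol, map_smul, map_one,
    LinearMap.smul_apply, smul_eq_mul, smul_eq_mul, smul_eq_mul, mul_one, pow_succ]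
  have : (-1 : ℝ) ^ n ≠ 0 := by simp
  rw [mul_assoc, mul_right_inj' this]
  constructor <;> intro h <;> linarith

end Pointwise

/-! ### Differentials of the coordinate functions -/

section Coordinates

variable {n N : ℕ} {G : Type*} [TopologicalSpace G] [ChartedSpace (EuclideanSpace ℝ (Fin N)) G]

/-- The projection of tangent vectors to the base. -/
def baseProj (p : Jet n N G) : TJ p →ₗ[ℝ] Base n :=
  (mfderiv (jetModel n N) 𝓘(ℝ, Base n) (fun q : Jet n N G => q.1) p :
    TJ p →L[ℝ] Base n).toLinearMap

theorem hasMFDerivAt_base (p : Jet n N G) : HasMFDerivAt (jetModel n N) 𝓘(ℝ, Base n)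
    (fun q : Jet n N G => q.1) p
    (ContinuousLinearMap.fst ℝ (Base n) (EuclideanSpace ℝ (Fin N) × Comp n N)) :=
  hasMFDerivAt_fst (I := 𝓘(ℝ, Base n)) (I' := (𝓡 N).prod 𝓘(ℝ, Comp n N)) p

theorem baseProj_apply (p : Jet n N G) (v : TJ p) : baseProj p v = v.1 :=
  congrArg (fun L => L v) (hasMFDerivAt_base p).mfderiv

theorem hasMFDerivAt_group_momentum (p : Jet n N G) :
    HasMFDerivAt (jetModel n N) ((𝓡 N).prod 𝓘(ℝ, Comp n N))
    (fun q : Jet n N G => q.2) p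
    (ContinuousLinearMap.snd ℝ (Base n) (EuclideanSpace ℝ (Fin N) × Comp n N)) :=
  hasMFDerivAt_snd (I := 𝓘(ℝ, Base n)) (I' := (𝓡 N).prod 𝓘(ℝ, Comp n N)) p

theorem hasMFDerivAt_group (p : Jet n N G) : HasMFDerivAt (jetModel n N) (𝓡 N)
    (fun q : Jet n N G => q.2.1) p
    ((ContinuousLinearMap.fst ℝ (EuclideanSpace ℝ (Fin N)) (Comp n N)).comp
      (ContinuousLinearMap.snd ℝ (Base n) (EuclideanSpace ℝ (Fin N) × Comp n N))) :=
  (hasMFDerivAt_fst (I := 𝓡 N) (I' := 𝓘(ℝ, Comp n N)) p.2).comp p (hasMFDerivAt_group_momentum p)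

theorem hasMFDerivAt_momentum (p : Jet n N G) : HasMFDerivAt (jetModel n N) 𝓘(ℝ, Comp n N)
    (fun q : Jet n N G => q.2.2) p
    ((ContinuousLinearMap.snd ℝ (EuclideanSpace ℝ (Fin N)) (Comp n N)).comp
      (ContinuousLinearMap.snd ℝ (Base n) (EuclideanSpace ℝ (Fin N) × Comp n N))) :=
  (hasMFDerivAt_snd (I := 𝓡 N) (I' := 𝓘(ℝ, Comp n N)) p.2).comp p (hasMFDerivAt_group_momentum p)

theorem hasMFDerivAt_base_coord (μ : Fin (n + 1)) (p : Jet n N G) :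
    HasMFDerivAt (jetModel n N) 𝓘(ℝ, ℝ)
    (fun q : Jet n N G => q.1 μ) p
    ((ContinuousLinearMap.proj (R := ℝ) (φ := fun _ : Fin (n + 1) => ℝ) μ).comp
      (ContinuousLinearMap.fst ℝ (Base n) (EuclideanSpace ℝ (Fin N) × Comp n N))) :=
  (ContinuousLinearMap.proj (R := ℝ) (φ := fun _ : Fin (n + 1) => ℝ) μ).hasMFDerivAt.comp p
    (hasMFDerivAt_base p)

/-- The coordinate functional `c ↦ c μ A`. -/
def compProj (μ : Fin (n + 1)) (A : Fin N) : Comp n N →L[ℝ] ℝ :=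
  (ContinuousLinearMap.proj (R := ℝ) (φ := fun _ : Fin N => ℝ) A).comp
    (ContinuousLinearMap.proj (R := ℝ) (φ := fun _ : Fin (n + 1) => Fin N → ℝ) μ)

theorem hasMFDerivAt_momentum_coord (μ : Fin (n + 1)) (A : Fin N) (p : Jet n N G) :
    HasMFDerivAt (jetModel n N) 𝓘(ℝ, ℝ)
    (fun q : Jet n N G => q.2.2 μ A) p
    ((compProj μ A).comp
    ((ContinuousLinearMap.snd ℝ (EuclideanSpace ℝ (Fin N)) (Comp n N)).comp
      (ContinuousLinearMap.snd ℝ (Base n) (EuclideanSpace ℝ (Fin N) × Comp n N)))) :=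
  (compProj μ A).hasMFDerivAt.comp p (hasMFDerivAt_momentum p)

theorem dx_apply (μ : Fin (n + 1)) (p : Jet n N G) (v : TJ p) : dx μ p v = v.1 μ :=
  congrArg (fun L => L v) (hasMFDerivAt_base_coord μ p).mfderiv

theorem dmom_apply (μ : Fin (n + 1)) (A : Fin N) (p : Jet n N G) (v : TJ p) :
    dmom μ A p v = v.2.2 μ A :=
  congrArg (fun L => L v) (hasMFDerivAt_momentum_coord μ A p).mfderiv

theorem dx_eq (μ : Fin (n + 1)) (p : Jet n N G) :
    dx μ p = (LinearMap.proj μ : Base n →ₗ[ℝ] ℝ).comp (baseProj p) :=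
  LinearMap.ext fun v => by rw [dx_apply, LinearMap.comp_apply, baseProj_apply]; rfl

theorem vol_eq (p : Jet n N G) : vol p = pullForm (baseProj p) (baseVol n) := by
  rw [vol, baseVol, map_list_prod, List.map_ofFn]
  congr 2
  funext μ
  simp only [Function.comp_apply]
  rw [pullForm_oneForm, dx_eq]

theorem baseProj_basex (μ : Fin (n + 1)) (p : Jet n N G) :
    baseProj p (basex μ p) = Pi.single μ 1 := baseProj_apply _ _

theorem dnx_eq (μ : Fin (n + 1)) (p : Jet n N G) :
    dnx μ p = pullForm (baseProj p) (baseVol1 μ) := by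
  rw [dnx, vol_eq, contract_pullForm, baseProj_basex, baseVol1]

theorem dn1x_eq (μ ν : Fin (n + 1)) (p : Jet n N G) :
    dn1x μ ν p = pullForm (baseProj p) (baseVol2 μ ν) := by
  rw [dn1x, dnx_eq, contract_pullForm, baseProj_basex, baseVol2]

/-! ### Pullback along tangent maps -/

section Chain

variable {F E' H : Type*} [NormedAddCommGroup E'] [NormedSpace ℝ E'] [TopologicalSpace H]
  {I : ModelWithCorners ℝ E' H} [TopologicalSpace F] [ChartedSpace H F]

theorem dFun_comp {f : Jet n N G → ℝ} {s : F → Jet n N G} {x : F}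
    (hf : MDifferentiableAt (jetModel n N) 𝓘(ℝ, ℝ) f (s x))
    (hs : MDifferentiableAt I (jetModel n N) s x) (v : TangentSpace I x) :
    dFun f (s x) (mfderiv I (jetModel n N) s x v) = mfderiv I 𝓘(ℝ, ℝ) (fun z => f (s z)) x v :=
  (mfderiv_comp_apply x hf hs v).symm

theorem baseProj_comp {s : F → Jet n N G} {x : F}
    (hs : MDifferentiableAt I (jetModel n N) s x) (v : TangentSpace I x) :
    baseProj (s x) (mfderiv I (jetModel n N) s x v)
      = mfderiv I 𝓘(ℝ, Base n) (fun z => (s z).1) x v :=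
  (mfderiv_comp_apply x (hasMFDerivAt_base (s x)).mdifferentiableAt hs v).symm

theorem dmom_comp {s : F → Jet n N G} {x : F}
    (hs : MDifferentiableAt I (jetModel n N) s x) (μ : Fin (n + 1)) (A : Fin N)
    (v : TangentSpace I x) :
    dmom μ A (s x) (mfderiv I (jetModel n N) s x v)
      = mfderiv I 𝓘(ℝ, ℝ) (fun z => (s z).2.2 μ A) x v :=
  dFun_comp (hasMFDerivAt_momentum_coord μ A (s x)).mdifferentiableAt hs v

end Chain

variable [Group G] (b : Module.Basis (Fin N) ℝ (GroupLieAlgebra (𝓡 N) G))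

theorem lam_apply (A : Fin N) (p : Jet n N G) (v : TJ p) :
    lam b A p v = maurerCartan b A p.2.1 v.2.1 :=
  congrArg (fun L : TJ p →L[ℝ] TangentSpace (𝓡 N) p.2.1 => maurerCartan b A p.2.1 (L v))
    (hasMFDerivAt_group p).mfderiv

variable {F E' H : Type*} [NormedAddCommGroup E'] [NormedSpace ℝ E'] [TopologicalSpace H]
  {I : ModelWithCorners ℝ E' H} [TopologicalSpace F] [ChartedSpace H F]

theorem lam_comp {s : F → Jet n N G} {x : F}
    (hs : MDifferentiableAt I (jetModel n N) s x) (A : Fin N) (v : TangentSpace I x) :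
    lam b A (s x) (mfderiv I (jetModel n N) s x v)
      = maurerCartan b A (s x).2.1 (mfderiv I (𝓡 N) (fun z => (s z).2.1) x v) :=
  congrArg (maurerCartan b A (s x).2.1)
    (mfderiv_comp_apply x (hasMFDerivAt_group (s x)).mdifferentiableAt hs v).symm

end Coordinates

/-! ### Left-invariant frames -/

section Group

variable {n N : ℕ} {G : Type*} [TopologicalSpace G] [ChartedSpace (EuclideanSpace ℝ (Fin N)) G]
  [Group G] (b : Module.Basis (Fin N) ℝ (GroupLieAlgebra (𝓡 N) G)) [LieGroup (𝓡 N) ∞ G]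

/-- Chain rule for the composite of left translations by g⁻¹ and then by g. -/
theorem mulInvariantVectorField_mfderiv (g : G) (v : TangentSpace (𝓡 N) g) :
    mulInvariantVectorField (I := 𝓡 N)
      (mfderiv (𝓡 N) (𝓡 N) (fun a : G => g⁻¹ * a) g v : EuclideanSpace ℝ (Fin N)) g = v := by
  have hm : ∀ a c : G, MDifferentiableAt (𝓡 N) (𝓡 N) (fun x : G => a * x) c := fun a c =>
    (contMDiff_mul_left (I := 𝓡 N) (n := ∞)).contMDiffAt.mdifferentiableAt (by simp)
  have h1 := mfderiv_comp_apply (I := 𝓡 N) (I' := 𝓡 N) (I'' := 𝓡 N) g (hm g (g⁻¹ * g)) (hm g⁻¹ g) v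
  have h2 : (fun x : G => g * x) ∘ (fun x => g⁻¹ * x) = id := by ext x; simp
  rw [h2, mfderiv_id] at h1
  -- The equality g⁻¹ * g = 1 is not definitional; taking vectors in the common model space lets the
  -- base point be substituted.
  have h3 : ∀ c : G, c = 1 → ∀ w : EuclideanSpace ℝ (Fin N),
      (mfderiv (𝓡 N) (𝓡 N) (fun x : G => g * x) c w : EuclideanSpace ℝ (Fin N))
        = mfderiv (𝓡 N) (𝓡 N) (fun x : G => g * x) 1 w := by
    rintro c rfl w; rfl
  exact (h3 _ (inv_mul_cancel g) _).symm.trans h1.symm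

/-- Left-invariant vector fields depend linearly on their value at the identity. -/
def mulInvariantHom (g : G) : GroupLieAlgebra (𝓡 N) G →ₗ[ℝ] TangentSpace (𝓡 N) g :=
  (mfderiv (𝓡 N) (𝓡 N) (fun a : G => g * a) 1 :
    GroupLieAlgebra (𝓡 N) G →L[ℝ] EuclideanSpace ℝ (Fin N)).toLinearMap

theorem sum_maurerCartan_smul (g : G) (v : TangentSpace (𝓡 N) g) :
    ∑ A, maurerCartan b A g v • mulInvariantVectorField (b A) g = v := by
  conv_rhs => rw [← mulInvariantVectorField_mfderiv g v]
  have : ∀ u : GroupLieAlgebra (𝓡 N) G,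
      ∑ A, b.coord A u • mulInvariantHom g (b A) = mulInvariantHom g u := by
    intro u
    rw [← b.sum_repr u, map_sum]
    simp
  exact this _

theorem maurerCartan_mulInvariantVectorField (A : Fin N) (g : G) (u : GroupLieAlgebra (𝓡 N) G) :
    maurerCartan b A g (mulInvariantVectorField u g) = b.coord A u := by
  have hm : ∀ a c : G, MDifferentiableAt (𝓡 N) (𝓡 N) (fun x : G => a * x) c := fun a c =>
    (contMDiff_mul_left (I := 𝓡 N) (n := ∞)).contMDiffAt.mdifferentiableAt (by simp)
  have h1 := mfderiv_comp_apply (I := 𝓡 N) (I' := 𝓡 N) (I'' := 𝓡 N) 1 (hm g⁻¹ (g * 1)) (hm g 1) u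
  have h2 : (fun x : G => g⁻¹ * x) ∘ (fun x => g * x) = id := by ext x; simp
  rw [h2, mfderiv_id] at h1
  have h3 : ∀ c : G, c = g → ∀ w : EuclideanSpace ℝ (Fin N),
      (mfderiv (𝓡 N) (𝓡 N) (fun x : G => g⁻¹ * x) c w : EuclideanSpace ℝ (Fin N))
        = mfderiv (𝓡 N) (𝓡 N) (fun x : G => g⁻¹ * x) g w := by
    rintro c rfl w; rfl
  exact congrArg (b.coord A) ((h3 _ (mul_one g) _).symm.trans h1.symm)

/-- The invariant field is the tangent map of multiplication applied to the zero vector at g and to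
v at the identity, hence a composite of smooth maps. -/
theorem contMDiff_mulInvariantVectorField_infty (v : GroupLieAlgebra (𝓡 N) G) :
    ContMDiff (𝓡 N) (𝓡 N).tangent ∞
      (fun g : G => (⟨g, mulInvariantVectorField v g⟩ : TangentBundle (𝓡 N) G)) := by
  let fg : G → TangentBundle (𝓡 N) G := fun g => ⟨g, 0⟩
  have sfg : ContMDiff (𝓡 N) (𝓡 N).tangent ∞ fg := Bundle.contMDiff_zeroSection _ _
  let fv : G → TangentBundle (𝓡 N) G := fun _ => ⟨1, v⟩
  have sfv : ContMDiff (𝓡 N) (𝓡 N).tangent ∞ fv := contMDiff_const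
  have S₂ : ContMDiff ((𝓡 N).tangent.prod (𝓡 N).tangent) ((𝓡 N).prod (𝓡 N)).tangent ∞
      (equivTangentBundleProd (𝓡 N) G (𝓡 N) G).symm := contMDiff_equivTangentBundleProd_symm
  have S₃ : ContMDiff ((𝓡 N).prod (𝓡 N)).tangent (𝓡 N).tangent ∞
      (tangentMap ((𝓡 N).prod (𝓡 N)) (𝓡 N) (fun p : G × G => p.1 * p.2)) :=
    ContMDiff.contMDiff_tangentMap (contMDiff_mul (𝓡 N) ∞) (m := ∞) (by simp)
  convert! (S₃.comp S₂).comp (sfg.prodMk sfv) with g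
  · simp [fg, fv]
  · simp only [Function.comp_apply, tangentMap, fg, fv]
    rw [mfderiv_prod_eq_add_apply ((contMDiff_mul (𝓡 N) ∞).mdifferentiable (by simp) _)]
    exact (zero_add _).symm.trans
      (congrArg₂ (· + ·) (ContinuousLinearMap.map_zero _).symm rfl)

/-- The vector field on `J¹E*` with constant base and momentum components and left-invariant
group component. -/
def invariantField (w : Base n) (u : GroupLieAlgebra (𝓡 N) G) (m : Comp n N) (p : Jet n N G) :
    TJ p :=
  ((w, mulInvariantVectorField u p.2.1, m) : Base n × EuclideanSpace ℝ (Fin N) × Comp n N)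

theorem contMDiff_const_field {E : Type*} [NormedAddCommGroup E] [NormedSpace ℝ E] (w : E) :
    ContMDiff 𝓘(ℝ, E) 𝓘(ℝ, E).tangent ∞ (fun x : E => (⟨x, w⟩ : TangentBundle 𝓘(ℝ, E) E)) :=
  contMDiff_vectorSpace_iff_contDiff.2 contDiff_const

/-- These global smooth fields realise every choice of components in the frame dual to dx, λ, dπ, so
they suffice as test fields. -/
theorem contMDiff_invariantField (w : Base n) (u : GroupLieAlgebra (𝓡 N) G) (m : Comp n N) :
    ContMDiff (jetModel n N) (jetModel n N).tangent ∞ (fun p : Jet n N G =>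
      (⟨p, invariantField w u m p⟩ : TangentBundle (jetModel n N) (Jet n N G))) := by
  have h1 := (contMDiff_const_field w).comp
    (contMDiff_fst (I := 𝓘(ℝ, Base n)) (J := (𝓡 N).prod 𝓘(ℝ, Comp n N)) (M := Base n)
      (N := G × Comp n N) (n := ∞))
  have h2 := (contMDiff_mulInvariantVectorField_infty u).comp
    ((contMDiff_fst (I := 𝓡 N) (J := 𝓘(ℝ, Comp n N)) (M := G) (N := Comp n N) (n := ∞)).comp
    (contMDiff_snd (I := 𝓘(ℝ, Base n)) (J := (𝓡 N).prod 𝓘(ℝ, Comp n N)) (M := Base n)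
      (N := G × Comp n N) (n := ∞)))
  have h3 := (contMDiff_const_field m).comp
    ((contMDiff_snd (I := 𝓡 N) (J := 𝓘(ℝ, Comp n N)) (M := G) (N := Comp n N) (n := ∞)).comp
    (contMDiff_snd (I := 𝓘(ℝ, Base n)) (J := (𝓡 N).prod 𝓘(ℝ, Comp n N)) (M := Base n)
      (N := G × Comp n N) (n := ∞)))
  exact (contMDiff_equivTangentBundleProd_symm (I := 𝓘(ℝ, Base n))
      (I' := (𝓡 N).prod 𝓘(ℝ, Comp n N)) (M := Base n) (M' := G × Comp n N) (n := ∞)).comp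
    (h1.prodMk ((contMDiff_equivTangentBundleProd_symm (I := 𝓡 N)
      (I' := 𝓘(ℝ, Comp n N)) (M := G) (M' := Comp n N) (n := ∞)).comp (h2.prodMk h3)))

/-- Provides the regularity under which the bracket on the Lie algebra is skew and bilinear. -/
theorem lieGroup_minSmoothness : LieGroup (𝓡 N) (minSmoothness ℝ 3) G :=
  LieGroup.of_le (n := ∞) (by rw [minSmoothness_of_isRCLikeNormedField]; exact ENat.LEInfty.out)

theorem structConst_swap (A B C : Fin N) : structConst b A B C = -structConst b A C B := by
  have := lieGroup_minSmoothness (N := N) (G := G)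
  rw [structConst, structConst, ← lie_skew, map_neg]

theorem coad_sum (a : Fin N → ℝ) (π : Fin N → ℝ) (A : Fin N) :
    coad b (lieVec b a) π A = ∑ B, a B * coad b (b B) π A := by
  have := lieGroup_minSmoothness (N := N) (G := G)
  simp only [coad, lieVec, sum_lie, smul_lie, map_sum, map_smul, Finset.mul_sum, smul_eq_mul]
  rw [Finset.sum_comm]
  refine Finset.sum_congr rfl fun B _ => Finset.sum_congr rfl fun C _ => by ring

end Group

/-! ### Functions in the adapted local system -/

section Functions

variable {n N : ℕ} {G : Type*} [TopologicalSpace G] [ChartedSpace (EuclideanSpace ℝ (Fin N)) G]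
  {U : Set (Base n)} {y : OpenPartialHomeomorph G (EuclideanSpace ℝ (Fin N))}

theorem isOpen_coordDomain (hU : IsOpen U) : IsOpen (coordDomain U y : Set (Jet n N G)) :=
  (hU.preimage continuous_fst).inter (y.open_source.preimage (continuous_fst.comp continuous_snd))

/-- The coordinate expression of a function. -/
def inCoords (y : OpenPartialHomeomorph G (EuclideanSpace ℝ (Fin N))) (f : Jet n N G → ℝ)
    (z : Base n × EuclideanSpace ℝ (Fin N) × Comp n N) : ℝ :=
  f (z.1, y.symm z.2.1, z.2.2)

/-- The adapted coordinates of a point. -/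
def toCoords (y : OpenPartialHomeomorph G (EuclideanSpace ℝ (Fin N))) (p : Jet n N G) :
    Base n × EuclideanSpace ℝ (Fin N) × Comp n N :=
  (p.1, y p.2.1, p.2.2)

/-- The coordinate expression of `coordDomain`. -/
def coordRange (U : Set (Base n)) (y : OpenPartialHomeomorph G (EuclideanSpace ℝ (Fin N))) :
    Set (Base n × EuclideanSpace ℝ (Fin N) × Comp n N) :=
  {z | z.1 ∈ U ∧ z.2.1 ∈ y.target}

theorem isOpen_coordRange (hU : IsOpen U) : IsOpen (coordRange U y) :=
  (hU.preimage continuous_fst).inter (y.open_target.preimage (continuous_fst.comp continuous_snd))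

theorem toCoords_mem {p : Jet n N G} (hp : p ∈ coordDomain U y) : toCoords y p ∈ coordRange U y :=
  ⟨hp.1, y.map_source hp.2⟩

variable [IsManifold (𝓡 N) ∞ G]

theorem contDiffOn_inCoords (hy : y ∈ IsManifold.maximalAtlas (𝓡 N) ∞ G) {f : Jet n N G → ℝ}
    (hf : ContMDiffOn (jetModel n N) 𝓘(ℝ, ℝ) ∞ f (coordDomain U y)) :
    ContDiffOn ℝ ∞ (inCoords y f) (coordRange U y) := by
  rw [← contMDiffOn_iff_contDiffOn]
  refine ContMDiffOn.comp (t := coordDomain U y) (I' := jetModel n N) hf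
    (f := fun z : Base n × EuclideanSpace ℝ (Fin N) × Comp n N => (z.1, y.symm z.2.1, z.2.2)) ?_
    (fun z hz => ⟨hz.1, y.map_target hz.2⟩)
  refine contDiff_fst.contMDiff.contMDiffOn.prodMk (ContMDiffOn.prodMk ?_ ?_)
  · exact (contMDiffOn_symm_of_mem_maximalAtlas hy).comp
      (contDiff_fst.comp contDiff_snd).contMDiff.contMDiffOn fun z hz => hz.2
  · exact (contDiff_snd.comp contDiff_snd).contMDiff.contMDiffOn

theorem mdifferentiableAt_chart (hy : y ∈ IsManifold.maximalAtlas (𝓡 N) ∞ G) {g : G}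
    (hg : g ∈ y.source) : MDifferentiableAt (𝓡 N) (𝓡 N) y g :=
  (contMDiffAt_of_mem_maximalAtlas hy hg).mdifferentiableAt (by simp)

theorem mdifferentiableAt_chart_symm (hy : y ∈ IsManifold.maximalAtlas (𝓡 N) ∞ G)
    {z : EuclideanSpace ℝ (Fin N)}
    (hz : z ∈ y.target) : MDifferentiableAt (𝓡 N) (𝓡 N) y.symm z :=
  (contMDiffAt_symm_of_mem_maximalAtlas hy hz).mdifferentiableAt (by simp)

theorem mdifferentiableAt_toCoords (hy : y ∈ IsManifold.maximalAtlas (𝓡 N) ∞ G) {p : Jet n N G}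
    (hp : p.2.1 ∈ y.source) :
    MDifferentiableAt (jetModel n N) 𝓘(ℝ, Base n × EuclideanSpace ℝ (Fin N) × Comp n N)
      (toCoords y) p := by
  have h1 := (hasMFDerivAt_base p).mdifferentiableAt
  have h2 := (mdifferentiableAt_chart hy hp).comp p (hasMFDerivAt_group p).mdifferentiableAt
  have h3 := (hasMFDerivAt_momentum p).mdifferentiableAt
  exact h1.prodMk_space (h2.prodMk_space h3)

omit [IsManifold (𝓡 N) ∞ G] in
theorem fibre_eq_inCoords (f : Jet n N G → ℝ) {p : Jet n N G} (hp : p.2.1 ∈ y.source)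
    (c : Comp n N) : f (p.1, p.2.1, c) = inCoords y f (p.1, y p.2.1, c) := by
  rw [inCoords, y.left_inv hp]

/-- The partial derivative is taken with the other variables frozen. Writing it as a derivative of
the joint coordinate expression in a fixed direction makes its dependence on the point
differentiable. -/
theorem partialC_eq (hU : IsOpen U) (hy : y ∈ IsManifold.maximalAtlas (𝓡 N) ∞ G)
    {f : Jet n N G → ℝ} (hf : ContMDiffOn (jetModel n N) 𝓘(ℝ, ℝ) ∞ f (coordDomain U y))
    (μ : Fin (n + 1)) (A : Fin N) {p : Jet n N G} (hp : p ∈ coordDomain U y) :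
    partialC f μ A p
      = fderiv ℝ (inCoords y f) (toCoords y p) (0, 0, Pi.single μ (Pi.single A 1)) := by
  have hd : DifferentiableAt ℝ (inCoords y f) (toCoords y p) :=
    ((contDiffOn_inCoords hy hf).differentiableOn (by simp)).differentiableAt
      ((isOpen_coordRange hU).mem_nhds (toCoords_mem hp))
  have hi : HasFDerivAt (fun c : Comp n N => ((p.1, y p.2.1, c) :
      Base n × EuclideanSpace ℝ (Fin N) × Comp n N))
      ((0 : Comp n N →L[ℝ] Base n).prod ((0 : Comp n N →L[ℝ] EuclideanSpace ℝ (Fin N)).prod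
        (ContinuousLinearMap.id ℝ (Comp n N)))) p.2.2 :=
    (hasFDerivAt_const _ _).prodMk ((hasFDerivAt_const _ _).prodMk (hasFDerivAt_id _))
  rw [partialC]
  simp only [fibre_eq_inCoords f hp.2]
  have := (HasFDerivAt.comp p.2.2 (g := inCoords y f) hd.hasFDerivAt hi).fderiv
  exact congrArg (fun L => L (Pi.single μ (Pi.single A 1))) this

theorem mdifferentiableAt_partialC_array (hU : IsOpen U)
    (hy : y ∈ IsManifold.maximalAtlas (𝓡 N) ∞ G)
    {f : Jet n N G → ℝ} (hf : ContMDiffOn (jetModel n N) 𝓘(ℝ, ℝ) ∞ f (coordDomain U y))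
    {p : Jet n N G} (hp : p ∈ coordDomain U y) :
    MDifferentiableAt (jetModel n N) 𝓘(ℝ, Comp n N) (fun q μ A => partialC f μ A q) p := by
  have h1 : ContDiffOn ℝ ∞ (fderiv ℝ (inCoords y f)) (coordRange U y) :=
    (contDiffOn_inCoords hy hf).fderiv_of_isOpen (isOpen_coordRange hU) (by simp)
  have h2 : DifferentiableAt ℝ (fun z => (fun μ A => fderiv ℝ (inCoords y f) z
      (0, 0, Pi.single μ (Pi.single A 1)) : Comp n N)) (toCoords y p) :=
    differentiableAt_pi.2 fun μ => differentiableAt_pi.2 fun A =>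
      ((h1.differentiableOn (by simp)).differentiableAt
        ((isOpen_coordRange hU).mem_nhds (toCoords_mem hp))).clm_apply (differentiableAt_const _)
  refine (h2.mdifferentiableAt.comp p (mdifferentiableAt_toCoords hy hp.2)).congr_of_eventuallyEq ?_
  filter_upwards [(isOpen_coordDomain hU).mem_nhds hp] with q hq
  funext μ A
  exact partialC_eq hU hy hf μ A hq

theorem mdifferentiableAt_partialC (hU : IsOpen U) (hy : y ∈ IsManifold.maximalAtlas (𝓡 N) ∞ G)
    {f : Jet n N G → ℝ} (hf : ContMDiffOn (jetModel n N) 𝓘(ℝ, ℝ) ∞ f (coordDomain U y))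
    (μ : Fin (n + 1)) (A : Fin N) {p : Jet n N G} (hp : p ∈ coordDomain U y) :
    MDifferentiableAt (jetModel n N) 𝓘(ℝ, ℝ) (partialC f μ A) p :=
  (compProj μ A).mdifferentiableAt.comp p (mdifferentiableAt_partialC_array hU hy hf hp)

omit [IsManifold (𝓡 N) ∞ G] in
theorem mdifferentiableAt_of_contMDiffOn (hU : IsOpen U) {f : Jet n N G → ℝ}
    (hf : ContMDiffOn (jetModel n N) 𝓘(ℝ, ℝ) ∞ f (coordDomain U y)) {p : Jet n N G}
    (hp : p ∈ coordDomain U y) : MDifferentiableAt (jetModel n N) 𝓘(ℝ, ℝ) f p :=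
  (hf.contMDiffAt ((isOpen_coordDomain hU).mem_nhds hp)).mdifferentiableAt (by simp)

theorem mdifferentiableAt_legendre (hU : IsOpen U)
    (hy : y ∈ IsManifold.maximalAtlas (𝓡 N) ∞ G)
    {f : Jet n N G → ℝ} (hf : ContMDiffOn (jetModel n N) 𝓘(ℝ, ℝ) ∞ f (coordDomain U y))
    {p : Jet n N G} (hp : p ∈ coordDomain U y) :
    MDifferentiableAt (jetModel n N) (jetModel n N) (legendre f) p := by
  refine (hasMFDerivAt_base p).mdifferentiableAt.prodMk
    ((hasMFDerivAt_group p).mdifferentiableAt.prodMk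
      (mdifferentiableAt_partialC_array hU hy hf hp))

/-! ### The differential in the frame `dx`, `λ`, `dπ` -/

/-- The differential of a function on the group. -/
def groupDiff (φ : G → ℝ) (g : G) : Module.Dual ℝ (TangentSpace (𝓡 N) g) :=
  (mfderiv (𝓡 N) 𝓘(ℝ, ℝ) φ g : TangentSpace (𝓡 N) g →L[ℝ] ℝ).toLinearMap

theorem groupDiff_eq (hy : y ∈ IsManifold.maximalAtlas (𝓡 N) ∞ G) {φ : G → ℝ} {g : G}
    (hg : g ∈ y.source) (hφ : MDifferentiableAt (𝓡 N) 𝓘(ℝ, ℝ) φ g) (v : TangentSpace (𝓡 N) g) :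
    groupDiff φ g v = ∑ B, groupDiff (fun a => y a B) g v
        * fderiv ℝ (fun z => φ (y.symm z)) (y g) (EuclideanSpace.single B 1) := by
  have hs : y.symm (y g) = g := y.left_inv hg
  have hψ : MDifferentiableAt (𝓡 N) 𝓘(ℝ, ℝ) (fun z => φ (y.symm z)) (y g) :=
    MDifferentiableAt.comp (y g) (I' := 𝓡 N) (g := φ) (by rwa [hs])
      (mdifferentiableAt_chart_symm hy (y.map_source hg))
  obtain ⟨L, hL⟩ : ∃ L : TangentSpace (𝓡 N) g →L[ℝ] EuclideanSpace ℝ (Fin N),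
      HasMFDerivAt (𝓡 N) (𝓡 N) y g L := ⟨_, (mdifferentiableAt_chart hy hg).hasMFDerivAt⟩
  have h1 : groupDiff φ g v = fderiv ℝ (fun z => φ (y.symm z)) (y g) (L v) := by
    have h := HasMFDerivAt.comp g hψ.hasMFDerivAt hL
    rw [mfderiv_eq_fderiv] at h
    have h' : HasMFDerivAt (𝓡 N) 𝓘(ℝ, ℝ) φ g _ := h.congr_of_eventuallyEq <| by
      filter_upwards [y.open_source.mem_nhds hg] with a ha
      simp only [Function.comp_apply, y.left_inv ha]
    exact congrArg (fun L : TangentSpace (𝓡 N) g →L[ℝ] ℝ => L v) h'.mfderiv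
  have h2 : ∀ B, groupDiff (fun a => y a B) g v = L v B := fun B =>
    congrArg (fun L : TangentSpace (𝓡 N) g →L[ℝ] ℝ => L v)
      (HasMFDerivAt.comp g (EuclideanSpace.proj (𝕜 := ℝ) B).hasMFDerivAt hL).mfderiv
  rw [h1]
  simp only [h2]
  generalize L v = u
  conv_lhs => rw [show u = ∑ B, u B • EuclideanSpace.single B (1 : ℝ) by
    ext i; simp [Pi.single_apply]]
  rw [map_sum]
  simp

theorem clm_base_apply (L : Base n →L[ℝ] ℝ) (w : Base n) :
    L w = ∑ ν, L (Pi.single ν 1) * w ν := by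
  conv_lhs => rw [base_eq_sum w]
  simp [mul_comm]

theorem clm_comp_apply (L : Comp n N →L[ℝ] ℝ) (c : Comp n N) :
    L c = ∑ μ, ∑ A, L (Pi.single μ (Pi.single A 1)) * c μ A := by
  conv_lhs => rw [show c = ∑ μ, ∑ A, c μ A • (Pi.single μ (Pi.single A 1) : Comp n N) by
    ext μ A; simp [Finset.sum_apply, Pi.single_apply, ite_apply]]
  simp [mul_comm]

end Functions

section Frame

variable {n N : ℕ} {G : Type*} [TopologicalSpace G] [ChartedSpace (EuclideanSpace ℝ (Fin N)) G]
  {U : Set (Base n)} {y : OpenPartialHomeomorph G (EuclideanSpace ℝ (Fin N))}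
  [Group G] (b : Module.Basis (Fin N) ℝ (GroupLieAlgebra (𝓡 N) G)) [LieGroup (𝓡 N) ∞ G]

/-- The term T^B_A ∂f/∂y^B is the derivative of f along the left-invariant field of e_A, so the
chart disappears. -/
theorem fibreTerm_eq (hy : y ∈ IsManifold.maximalAtlas (𝓡 N) ∞ G) {f : Jet n N G → ℝ}
    {p : Jet n N G} (hp : p.2.1 ∈ y.source)
    (hf : MDifferentiableAt (𝓡 N) 𝓘(ℝ, ℝ) (fun a => f (p.1, a, p.2.2)) p.2.1) (A : Fin N) :
    fibreTerm b y f A p = groupDiff (fun a => f (p.1, a, p.2.2)) p.2.1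
      (mulInvariantVectorField (b A) p.2.1) :=
  (groupDiff_eq hy hp hf _).symm

theorem dFun_apply (hy : y ∈ IsManifold.maximalAtlas (𝓡 N) ∞ G) {f : Jet n N G → ℝ}
    {p : Jet n N G} (hp : p.2.1 ∈ y.source)
    (hf : MDifferentiableAt (jetModel n N) 𝓘(ℝ, ℝ) f p) (v : TJ p) :
    dFun f p v = ∑ ν, partialX f ν p * dx ν p v + ∑ A, fibreTerm b y f A p * lam b A p v
      + ∑ μ, ∑ A, partialC f μ A p * dmom μ A p v := by
  have hf2 : MDifferentiableAt ((𝓡 N).prod 𝓘(ℝ, Comp n N)) 𝓘(ℝ, ℝ) (fun z => f (p.1, z)) p.2 :=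
    MDifferentiableAt.comp (I' := jetModel n N) (g := f) (f := fun z => (p.1, z)) p.2 hf
      (mdifferentiableAt_const.prodMk mdifferentiableAt_id)
  have hf3 : MDifferentiableAt (𝓡 N) 𝓘(ℝ, ℝ) (fun a => f (p.1, a, p.2.2)) p.2.1 :=
    MDifferentiableAt.comp (I' := (𝓡 N).prod 𝓘(ℝ, Comp n N)) (g := fun z => f (p.1, z))
      (f := fun a => (a, p.2.2)) p.2.1 hf2 (mdifferentiableAt_id.prodMk mdifferentiableAt_const)
  have e1 : dFun f p v = fderiv ℝ (fun x => f (x, p.2)) p.1 v.1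
      + (groupDiff (fun a => f (p.1, a, p.2.2)) p.2.1 v.2.1
        + fderiv ℝ (fun c => f (p.1, p.2.1, c)) p.2.2 v.2.2) := by
    rw [← mfderiv_eq_fderiv, ← mfderiv_eq_fderiv]
    exact (mfderiv_prod_eq_add_apply hf).trans
      (congrArg₂ (· + ·) rfl (mfderiv_prod_eq_add_apply hf2))
  have e2 : groupDiff (fun a => f (p.1, a, p.2.2)) p.2.1 v.2.1
      = ∑ A, fibreTerm b y f A p * lam b A p v := by
    simp only [fibreTerm_eq b hy hp hf3, lam_apply]
    conv_lhs => rw [← sum_maurerCartan_smul b p.2.1 v.2.1]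
    rw [map_sum]
    simp only [map_smul, smul_eq_mul, mul_comm]
  rw [e1, e2, clm_base_apply, clm_comp_apply]
  simp only [dx_apply, dmom_apply, partialX, partialC]
  ring

end Frame

/-! ### The forms `ψ^μ` -/

section Psi

variable {n N : ℕ} {G : Type*} [TopologicalSpace G] [ChartedSpace (EuclideanSpace ℝ (Fin N)) G]
  [Group G] (b : Module.Basis (Fin N) ℝ (GroupLieAlgebra (𝓡 N) G))

theorem oneForm_mul_oneForm_mem {V : Type*} [AddCommGroup V] [Module ℝ V]
    (α β : Module.Dual ℝ V) : oneForm α * oneForm β ∈ formsOfDegree V 2 :=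
  mul_mem_formsOfDegree (oneForm_mem α) (oneForm_mem β)

theorem psi_mem (μ : Fin (n + 1)) (p : Jet n N G) : psi b μ p ∈ formsOfDegree (TJ p) 2 :=
  Submodule.sum_mem _ fun _ _ => Submodule.add_mem _ (oneForm_mul_oneForm_mem _ _)
    (Submodule.smul_mem _ _ (Submodule.smul_mem _ _ (Submodule.sum_mem _ fun _ _ =>
      Submodule.sum_mem _ fun _ _ => Submodule.smul_mem _ _ (oneForm_mul_oneForm_mem _ _))))

theorem coadLam_apply (μ : Fin (n + 1)) (A : Fin N) (p : Jet n N G) (v : TJ p) :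
    coadLam b μ A p v = ∑ B, coad b (b B) (p.2.2 μ) A * lam b B p v := by
  simp [coadLam]

theorem coad_basis (B A : Fin N) (π : Fin N → ℝ) :
    coad b (b B) π A = ∑ C, π C * structConst b C B A := rfl

variable [LieGroup (𝓡 N) ∞ G]

/-- The factor 1/2 compensates for the two equal contributions of each wedge. The lower indices are
exchanged, with a sign, to match those of the coadjoint action. -/
theorem eval2_lamBracket (A : Fin N) (p : Jet n N G) (v w : TJ p) :
    eval2 (lamBracket b A p) v w
      = -∑ B, ∑ C, structConst b A C B * lam b B p v * lam b C p w := by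
  have h : ∑ B, ∑ C, structConst b A B C * (lam b B p w * lam b C p v)
      = ∑ B, ∑ C, structConst b A C B * (lam b B p v * lam b C p w) := by
    rw [Finset.sum_comm]
    exact Finset.sum_congr rfl fun B _ => Finset.sum_congr rfl fun C _ => by ring
  have h' : ∑ B, ∑ C, structConst b A B C * (lam b B p v * lam b C p w)
      = -∑ B, ∑ C, structConst b A C B * (lam b B p v * lam b C p w) := by
    simp only [← Finset.sum_neg_distrib]
    exact Finset.sum_congr rfl fun B _ => Finset.sum_congr rfl fun C _ => by
      rw [structConst_swap]; ring
  simp only [lamBracket, eval2_smul, eval2_sum, eval2_mul, mul_sub, Finset.sum_sub_distrib, h, h',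
    mul_assoc]
  ring

/-- The bracket term is exactly what completes dπ to dπ − ad*_λ π in one of the two slots. -/
theorem eval2_psi (μ : Fin (n + 1)) (p : Jet n N G) (v w : TJ p) :
    eval2 (psi b μ p) v w = ∑ A, lam b A p v * (dmom μ A p w - coadLam b μ A p w)
      - ∑ A, lam b A p w * dmom μ A p v := by
  have h : ∑ A, p.2.2 μ A * eval2 (lamBracket b A p) v w
      = -∑ A, lam b A p v * coadLam b μ A p w := by
    simp only [eval2_lamBracket, coadLam_apply, coad_basis, mul_neg, Finset.sum_neg_distrib,
      Finset.mul_sum, Finset.sum_mul, neg_inj]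
    rw [Finset.sum_comm]
    refine Finset.sum_congr rfl fun B _ => ?_
    rw [Finset.sum_comm]
    exact Finset.sum_congr rfl fun C _ => Finset.sum_congr rfl fun D _ => by ring
  simp only [psi, eval2_sum, eval2_add, eval2_smul, eval2_mul, Finset.sum_add_distrib, h,
    mul_sub, Finset.sum_sub_distrib]
  ring

end Psi

/-! ### Sections -/

section Sections

variable {n N : ℕ} {G : Type*} [TopologicalSpace G] [ChartedSpace (EuclideanSpace ℝ (Fin N)) G]
  {U : Set (Base n)} {y : OpenPartialHomeomorph G (EuclideanSpace ℝ (Fin N))}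
  {g : Base n → G} {ϖ : Base n → Comp n N} {x : Base n}

theorem mdifferentiableAt_sec (hU : IsOpen U) (hg : ContMDiffOn 𝓘(ℝ, Base n) (𝓡 N) ∞ g U)
    (hϖ : ContDiffOn ℝ ∞ ϖ U) (hx : x ∈ U) :
    MDifferentiableAt 𝓘(ℝ, Base n) (jetModel n N) (sec g ϖ) x := by
  have hn := hU.mem_nhds hx
  exact mdifferentiableAt_id.prodMk (((hg.contMDiffAt hn).mdifferentiableAt (by simp)).prodMk
    ((hϖ.differentiableOn (by simp)).differentiableAt hn).mdifferentiableAt)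

theorem baseProj_comp_tangentSec
    (hs : MDifferentiableAt 𝓘(ℝ, Base n) (jetModel n N) (sec g ϖ) x) :
    (baseProj (sec g ϖ x)).comp (tangentSec g ϖ x) = LinearMap.id :=
  LinearMap.ext fun v => (baseProj_comp hs v).trans <| by
    have : (mfderiv 𝓘(ℝ, Base n) 𝓘(ℝ, Base n) (fun z : Base n => z) x) = _ := mfderiv_id
    exact congrArg (fun L : Base n →L[ℝ] Base n => L v) this

theorem dx_tangentFrame (hs : MDifferentiableAt 𝓘(ℝ, Base n) (jetModel n N) (sec g ϖ) x)
    (μ ν : Fin (n + 1)) :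
    dx μ (sec g ϖ x) (tangentFrame g ϖ x ν) = if μ = ν then 1 else 0 := by
  have := LinearMap.congr_fun (baseProj_comp_tangentSec hs) (Pi.single ν 1)
  rw [dx_eq, tangentFrame]
  change (baseProj (sec g ϖ x) (tangentSec g ϖ x (Pi.single ν 1)) : Base n) μ = _
  rw [show baseProj (sec g ϖ x) (tangentSec g ϖ x (Pi.single ν 1)) = Pi.single ν 1 from this,
    Pi.single_apply]

theorem dmom_tangentFrame (hs : MDifferentiableAt 𝓘(ℝ, Base n) (jetModel n N) (sec g ϖ) x)
    (μ ν : Fin (n + 1)) (A : Fin N) :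
    dmom μ A (sec g ϖ x) (tangentFrame g ϖ x ν)
      = fderiv ℝ (fun x' => ϖ x' μ A) x (Pi.single ν 1) := by
  rw [← mfderiv_eq_fderiv]
  exact dmom_comp hs μ A (Pi.single ν 1 : Base n)

theorem pullSec_vol (hs : MDifferentiableAt 𝓘(ℝ, Base n) (jetModel n N) (sec g ϖ) x) :
    pullSec g ϖ x (vol (sec g ϖ x)) = baseVol n := by
  rw [pullSec, vol_eq, pullForm_section (baseProj_comp_tangentSec hs)]

theorem pullSec_oneForm_mul_dnx
    (hs : MDifferentiableAt 𝓘(ℝ, Base n) (jetModel n N) (sec g ϖ) x)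
    (α : Module.Dual ℝ (TJ (sec g ϖ x))) (μ : Fin (n + 1)) :
    pullSec g ϖ x (oneForm α * dnx μ (sec g ϖ x)) = α (tangentFrame g ϖ x μ) • baseVol n := by
  rw [pullSec, map_mul, dnx_eq, pullForm_section (baseProj_comp_tangentSec hs), pullForm_oneForm,
    oneForm_mul_baseVol1]
  rfl

theorem pullSec_mul_dn1x (hs : MDifferentiableAt 𝓘(ℝ, Base n) (jetModel n N) (sec g ϖ) x)
    {ψ : ExtForm (TJ (sec g ϖ x))} (hψ : ψ ∈ formsOfDegree (TJ (sec g ϖ x)) 2)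
    (μ ν : Fin (n + 1)) :
    pullSec g ϖ x (ψ * dn1x μ ν (sec g ϖ x))
      = eval2 ψ (tangentFrame g ϖ x μ) (tangentFrame g ϖ x ν) • baseVol n := by
  rw [pullSec, map_mul, dn1x_eq, pullForm_section (baseProj_comp_tangentSec hs),
    mul_baseVol2_of_degree_two (pullForm_mem_formsOfDegree _ hψ), eval2_pullForm]
  rfl

variable [Group G] (b : Module.Basis (Fin N) ℝ (GroupLieAlgebra (𝓡 N) G))
  {h : Jet n N G → ℝ}

theorem Dh_apply (v : TJ (sec g ϖ x)) :
    Dh b h g ϖ x v = dFun h (sec g ϖ x) v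
      - ∑ α, partialX h α (sec g ϖ x) * dx α (sec g ϖ x) v
      - ∑ α, (∑ μ, eval2 (psi b μ (sec g ϖ x)) (tangentFrame g ϖ x μ) (tangentFrame g ϖ x α))
        * dx α (sec g ϖ x) v := by
  simp [Dh, eval2]

theorem Dh_tangentFrame (hs : MDifferentiableAt 𝓘(ℝ, Base n) (jetModel n N) (sec g ϖ) x)
    (ν : Fin (n + 1)) :
    Dh b h g ϖ x (tangentFrame g ϖ x ν)
      = dFun h (sec g ϖ x) (tangentFrame g ϖ x ν) - partialX h ν (sec g ϖ x)
        - ∑ μ, eval2 (psi b μ (sec g ϖ x)) (tangentFrame g ϖ x μ) (tangentFrame g ϖ x ν) := by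
  rw [Dh_apply]
  simp [dx_tangentFrame hs]

theorem energyBalance_iff
    (hs : ∀ x ∈ U, MDifferentiableAt 𝓘(ℝ, Base n) (jetModel n N) (sec g ϖ) x) :
    EnergyBalance b h U g ϖ ↔ ∀ x ∈ U, ∀ ν, Dh b h g ϖ x (tangentFrame g ϖ x ν) = 0 := by
  refine forall₃_congr fun x hx ν => ?_
  rw [map_sub, map_sub, map_sum, map_smul, pullSec_oneForm_mul_dnx (hs x hx), pullSec_vol (hs x hx),
    Finset.sum_congr rfl fun μ _ => pullSec_mul_dn1x (hs x hx) (psi_mem b μ _) μ ν,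
    ← Finset.sum_smul, ← sub_smul, ← sub_smul, baseVol_smul_eq_zero_iff, Dh_tangentFrame b (hs x hx)]

theorem momentumForm_iff
    (hs : ∀ x ∈ U, MDifferentiableAt 𝓘(ℝ, Base n) (jetModel n N) (sec g ϖ) x) :
    MomentumForm b y h U g ϖ ↔
      ∀ x ∈ U, ∀ A, ∑ μ, tau b y h μ A (sec g ϖ x) (tangentFrame g ϖ x μ) = 0 := by
  refine forall₃_congr fun x hx A => ?_
  rw [map_sum, Finset.sum_congr rfl fun μ _ => pullSec_oneForm_mul_dnx (hs x hx) _ μ,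
    ← Finset.sum_smul, baseVol_smul_eq_zero_iff]

theorem contactForm_iff
    (hs : ∀ x ∈ U, MDifferentiableAt 𝓘(ℝ, Base n) (jetModel n N) (sec g ϖ) x) :
    ContactForm b h U g ϖ ↔
      ∀ x ∈ U, ∀ A μ, contactHam b h A (sec g ϖ x) (tangentFrame g ϖ x μ) = 0 := by
  refine forall₄_congr fun x hx A μ => ?_
  rw [pullSec_oneForm_mul_dnx (hs x hx), baseVol_smul_eq_zero_iff]

theorem contactHam_tangentFrame
    (hs : MDifferentiableAt 𝓘(ℝ, Base n) (jetModel n N) (sec g ϖ) x) (A : Fin N)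
    (μ : Fin (n + 1)) :
    contactHam b h A (sec g ϖ x) (tangentFrame g ϖ x μ)
      = lam b A (sec g ϖ x) (tangentFrame g ϖ x μ) - partialC h μ A (sec g ϖ x) := by
  simp [contactHam, dx_tangentFrame hs]

theorem sum_tau_tangentFrame
    (hs : MDifferentiableAt 𝓘(ℝ, Base n) (jetModel n N) (sec g ϖ) x) (A : Fin N) :
    ∑ μ, tau b y h μ A (sec g ϖ x) (tangentFrame g ϖ x μ)
      = ∑ μ, (dmom μ A (sec g ϖ x) (tangentFrame g ϖ x μ)
          - coadLam b μ A (sec g ϖ x) (tangentFrame g ϖ x μ)) + fibreTerm b y h A (sec g ϖ x) := by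
  have : (n : ℝ) + 1 ≠ 0 := by positivity
  simp only [tau, LinearMap.add_apply, LinearMap.sub_apply, LinearMap.smul_apply,
    dx_tangentFrame hs, if_true, smul_eq_mul, mul_one, Finset.sum_add_distrib, Finset.sum_const,
    Finset.card_univ, Fintype.card_fin, nsmul_eq_mul, Nat.cast_add, Nat.cast_one]
  -- The n + 1 summands with factor 1/(n+1) add up to a single copy of the fibre term.
  field_simp

theorem inverseLegendre_iff
    (hs : ∀ x ∈ U, MDifferentiableAt 𝓘(ℝ, Base n) (jetModel n N) (sec g ϖ) x) :
    InverseLegendre b h U g ϖ ↔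
      ∀ x ∈ U, ∀ A μ, contactHam b h A (sec g ϖ x) (tangentFrame g ϖ x μ) = 0 := by
  refine forall₃_congr fun x hx A => ?_
  simp only [contactHam_tangentFrame b (hs x hx), sub_eq_zero]
  constructor
  · intro H μ
    have := LinearMap.congr_fun H (Pi.single μ 1)
    simpa [Pi.single_apply, tangentFrame] using this
  · intro H
    rw [dual_base_eq_sum ((lam b A (sec g ϖ x)).comp (tangentSec g ϖ x))]
    exact Finset.sum_congr rfl fun μ _ => congrArg (· • _) (H μ)

variable [LieGroup (𝓡 N) ∞ G]

/-- Along the section the contact equation replaces λ(X_μ) by ∂h/∂π^μ, so ad*_λ turns into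
ad*_{∂h/∂π^μ} by linearity. -/
theorem momentumEquation_iff
    (hs : ∀ x ∈ U, MDifferentiableAt 𝓘(ℝ, Base n) (jetModel n N) (sec g ϖ) x)
    (hc : ∀ x ∈ U, ∀ A μ, contactHam b h A (sec g ϖ x) (tangentFrame g ϖ x μ) = 0) :
    MomentumEquation b y h U g ϖ ↔
      ∀ x ∈ U, ∀ A, ∑ μ, tau b y h μ A (sec g ϖ x) (tangentFrame g ϖ x μ) = 0 := by
  refine forall₃_congr fun x hx A => ?_
  have hl : ∀ μ A, lam b A (sec g ϖ x) (tangentFrame g ϖ x μ) = partialC h μ A (sec g ϖ x) :=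
    fun μ A => by
      rw [← sub_eq_zero, ← contactHam_tangentFrame b (hs x hx)]; exact hc x hx A μ
  rw [sum_tau_tangentFrame b (hs x hx), Finset.sum_sub_distrib]
  simp only [coad_sum, coadLam_apply, hl, dmom_tangentFrame (hs x hx), mul_comm]
  rfl

theorem sum_eval2_psi (hs : MDifferentiableAt 𝓘(ℝ, Base n) (jetModel n N) (sec g ϖ) x)
    (v : TJ (sec g ϖ x)) :
    ∑ μ, eval2 (psi b μ (sec g ϖ x)) v (tangentFrame g ϖ x μ)
      = ∑ A, lam b A (sec g ϖ x) v *
          (∑ μ, tau b y h μ A (sec g ϖ x) (tangentFrame g ϖ x μ) - fibreTerm b y h A (sec g ϖ x))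
        - ∑ μ, ∑ A, lam b A (sec g ϖ x) (tangentFrame g ϖ x μ) * dmom μ A (sec g ϖ x) v := by
  simp only [sum_tau_tangentFrame b hs, add_sub_cancel_right, eval2_psi, Finset.sum_sub_distrib,
    Finset.mul_sum, mul_sub]
  rw [Finset.sum_comm]
  congr 2
  rw [Finset.sum_comm]

/-- The central identity: the λ part of dh cancels the fibre term left over from τ, and the dπ part
combines with λ(X_μ) into the contact form. -/
theorem sum_eval2_psi_add (hy : y ∈ IsManifold.maximalAtlas (𝓡 N) ∞ G)
    (hp : g x ∈ y.source)
    (hs : MDifferentiableAt 𝓘(ℝ, Base n) (jetModel n N) (sec g ϖ) x)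
    (hh : MDifferentiableAt (jetModel n N) 𝓘(ℝ, ℝ) h (sec g ϖ x)) (v : TJ (sec g ϖ x)) :
    ∑ μ, eval2 (psi b μ (sec g ϖ x)) v (tangentFrame g ϖ x μ) + dFun h (sec g ϖ x) v
      = ∑ ν, partialX h ν (sec g ϖ x) * dx ν (sec g ϖ x) v
        + ∑ A, lam b A (sec g ϖ x) v *
          ∑ μ, tau b y h μ A (sec g ϖ x) (tangentFrame g ϖ x μ)
        - ∑ μ, ∑ A, contactHam b h A (sec g ϖ x) (tangentFrame g ϖ x μ)
          * dmom μ A (sec g ϖ x) v := by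
  rw [sum_eval2_psi (y := y) (h := h) b hs, dFun_apply b hy hp hh]
  simp only [contactHam_tangentFrame b hs, mul_sub, sub_mul, Finset.sum_sub_distrib,
    mul_comm (fibreTerm b y h _ _)]
  ring

theorem omegaStar_eq (p : Jet n N G) :
    omegaStar b p = ∑ μ, psi b μ p * pullForm (baseProj p) (baseVol1 μ) := by
  simp only [omegaStar, dnx_eq]

theorem pullSec_contract_omegaHam (hy : y ∈ IsManifold.maximalAtlas (𝓡 N) ∞ G)
    (hp : g x ∈ y.source)
    (hs : MDifferentiableAt 𝓘(ℝ, Base n) (jetModel n N) (sec g ϖ) x)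
    (hh : MDifferentiableAt (jetModel n N) 𝓘(ℝ, ℝ) h (sec g ϖ x)) (v : TJ (sec g ϖ x)) :
    pullSec g ϖ x (contract v (omegaHam b h (sec g ϖ x)))
      = (∑ A, lam b A (sec g ϖ x) v *
          ∑ μ, tau b y h μ A (sec g ϖ x) (tangentFrame g ϖ x μ)
        - ∑ μ, ∑ A, contactHam b h A (sec g ϖ x) (tangentFrame g ϖ x μ)
          * dmom μ A (sec g ϖ x) v
        - ∑ ν, dx ν (sec g ϖ x) v * Dh b h g ϖ x (tangentFrame g ϖ x ν)) • baseVol n := by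
  rw [omegaHam, map_add, map_add, omegaStar_eq, vol_eq, pullSec,
    pullForm_contract_omega (baseProj_comp_tangentSec hs) (fun μ => psi_mem b μ _),
    pullForm_contract_oneForm_mul_vol (baseProj_comp_tangentSec hs), ← add_smul]
  congr 1
  have := sum_eval2_psi_add b hy hp hs hh v
  have hd : ∀ ν, baseProj (sec g ϖ x) v ν = dx ν (sec g ϖ x) v := fun ν => by rw [dx_eq]; rfl
  simp only [Dh_tangentFrame b hs, mul_sub, Finset.sum_sub_distrib, hd]
  change _ + ∑ ν, _ * ∑ μ, eval2 _ (tangentFrame g ϖ x μ) (tangentFrame g ϖ x ν)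
    + (_ - ∑ ν, _ * dFun h (sec g ϖ x) (tangentFrame g ϖ x ν)) = _
  change ∑ μ, eval2 _ v (tangentFrame g ϖ x μ) + _ + _ = _
  simp only [mul_comm (partialX h _ _)] at this
  linarith

theorem multiContract_omegaStar_eq_iff (hy : y ∈ IsManifold.maximalAtlas (𝓡 N) ∞ G)
    (hp : g x ∈ y.source)
    (hs : MDifferentiableAt 𝓘(ℝ, Base n) (jetModel n N) (sec g ϖ) x)
    (hh : MDifferentiableAt (jetModel n N) 𝓘(ℝ, ℝ) h (sec g ϖ x)) :
    multiContract (tangentFrame g ϖ x) (omegaStar b (sec g ϖ x))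
        = oneForm ((-1 : ℝ) ^ n • Dh b h g ϖ x) ↔
      ∀ v : TJ (sec g ϖ x), ∑ A, lam b A (sec g ϖ x) v *
          ∑ μ, tau b y h μ A (sec g ϖ x) (tangentFrame g ϖ x μ)
        - ∑ μ, ∑ A, contactHam b h A (sec g ϖ x) (tangentFrame g ϖ x μ)
          * dmom μ A (sec g ϖ x) v = 0 := by
  rw [omegaStar_eq]
  refine (multiContract_omega_eq_iff (baseProj_comp_tangentSec hs) (fun μ => psi_mem b μ _)
    (Dh b h g ϖ x)).trans (forall_congr' fun v => ?_)
  have := sum_eval2_psi_add b hy hp hs hh v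
  have hd : ∀ ν, baseProj (sec g ϖ x) v ν = dx ν (sec g ϖ x) v := fun ν => by rw [dx_eq]; rfl
  simp only [hd]
  change ∑ μ, eval2 _ v (tangentFrame g ϖ x μ)
    + ∑ ν, _ * ∑ μ, eval2 _ (tangentFrame g ϖ x μ) (tangentFrame g ϖ x ν) + _ = 0 ↔ _
  rw [Dh_apply]
  simp only [mul_comm (∑ μ, eval2 _ _ _)]
  constructor <;> intro H <;> linarith

/-- Evaluate the equation on X_ν: the canonical form already contains X_ν among its arguments, so
its contribution vanishes. -/
theorem Dh_tangentFrame_eq_zero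
    (hs : MDifferentiableAt 𝓘(ℝ, Base n) (jetModel n N) (sec g ϖ) x)
    (H : multiContract (tangentFrame g ϖ x) (omegaStar b (sec g ϖ x))
        = oneForm ((-1 : ℝ) ^ n • Dh b h g ϖ x)) (ν : Fin (n + 1)) :
    Dh b h g ϖ x (tangentFrame g ϖ x ν) = 0 := by
  rw [omegaStar_eq] at H
  have h1 := (multiContract_omega_eq_iff (baseProj_comp_tangentSec hs)
    (fun μ => psi_mem b μ (sec g ϖ x)) (Dh b h g ϖ x)).1 H (tangentFrame g ϖ x ν)
  have h2 := contract_section_omega (baseProj_comp_tangentSec hs)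
    (fun μ => psi_mem b μ (sec g ϖ x)) ν
  rw [tangentFrame] at h1 ⊢
  linarith

theorem lam_invariantField (w : Base n) (a : Fin N → ℝ) (m : Comp n N) (A : Fin N)
    (p : Jet n N G) : lam b A p (invariantField w (lieVec b a) m p) = a A := by
  rw [lam_apply]
  refine (maurerCartan_mulInvariantVectorField b A p.2.1 (lieVec b a)).trans ?_
  simp [lieVec, Finsupp.single_apply]

theorem dx_invariantField (w : Base n) (u : GroupLieAlgebra (𝓡 N) G) (m : Comp n N)
    (ν : Fin (n + 1)) (p : Jet n N G) : dx ν p (invariantField w u m p) = w ν :=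
  dx_apply _ _ _

theorem dmom_invariantField (w : Base n) (u : GroupLieAlgebra (𝓡 N) G) (m : Comp n N)
    (μ : Fin (n + 1)) (A : Fin N) (p : Jet n N G) :
    dmom μ A p (invariantField w u m p) = m μ A :=
  dmom_apply _ _ _ _

/-- The equations of Hamiltonian sections, evaluated on the tangent frame. -/
def FrameEquations (y : OpenPartialHomeomorph G (EuclideanSpace ℝ (Fin N)))
    (h : Jet n N G → ℝ) (g : Base n → G) (ϖ : Base n → Comp n N) (x : Base n) : Prop :=
  (∀ μ, Dh b h g ϖ x (tangentFrame g ϖ x μ) = 0) ∧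
    (∀ A, ∑ μ, tau b y h μ A (sec g ϖ x) (tangentFrame g ϖ x μ) = 0) ∧
    ∀ A μ, contactHam b h A (sec g ϖ x) (tangentFrame g ϖ x μ) = 0

theorem isHamiltonianSection_iff (hy : y ∈ IsManifold.maximalAtlas (𝓡 N) ∞ G)
    (D : Set (Jet n N G)) (hp : ∀ x ∈ U, g x ∈ y.source)
    (hs : ∀ x ∈ U, MDifferentiableAt 𝓘(ℝ, Base n) (jetModel n N) (sec g ϖ) x)
    (hh : ∀ x ∈ U, MDifferentiableAt (jetModel n N) 𝓘(ℝ, ℝ) h (sec g ϖ x)) :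
    IsHamiltonianSection b h U D g ϖ ↔ ∀ x ∈ U, FrameEquations b y h g ϖ x := by
  constructor
  · intro H x hx
    have key : ∀ (w : Base n) (a : Fin N → ℝ) (m : Comp n N),
        ∑ A, a A * ∑ μ, tau b y h μ A (sec g ϖ x) (tangentFrame g ϖ x μ)
        - ∑ μ, ∑ A, contactHam b h A (sec g ϖ x) (tangentFrame g ϖ x μ) * m μ A
        - ∑ ν, w ν * Dh b h g ϖ x (tangentFrame g ϖ x ν) = 0 := by
      intro w a m
      have := H (invariantField w (lieVec b a) m) (contMDiff_invariantField _ _ _).contMDiffOn x hx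
      rw [pullSec_contract_omegaHam b hy (hp x hx) (hs x hx) (hh x hx),
        baseVol_smul_eq_zero_iff] at this
      simpa only [lam_invariantField, dx_invariantField, dmom_invariantField] using this
    -- Choosing one unit component of the test field at a time isolates each equation.
    refine ⟨fun μ => ?_, fun A => ?_, fun A μ => ?_⟩
    · simpa [Pi.single_apply] using key (Pi.single μ 1) 0 0
    · simpa [Pi.single_apply] using key 0 (Pi.single A 1) 0
    · simpa [Pi.single_apply, ite_apply] using key 0 0 (Pi.single μ (Pi.single A 1))
  · intro H W _ x hx
    obtain ⟨h1, h2, h3⟩ := H x hx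
    rw [pullSec_contract_omegaHam b hy (hp x hx) (hs x hx) (hh x hx)]
    simp [h1, h2, h3]

theorem multiContract_omegaStar_eq_iff_frameEquations
    (hy : y ∈ IsManifold.maximalAtlas (𝓡 N) ∞ G) (hp : g x ∈ y.source)
    (hs : MDifferentiableAt 𝓘(ℝ, Base n) (jetModel n N) (sec g ϖ) x)
    (hh : MDifferentiableAt (jetModel n N) 𝓘(ℝ, ℝ) h (sec g ϖ x)) :
    multiContract (tangentFrame g ϖ x) (omegaStar b (sec g ϖ x))
        = oneForm ((-1 : ℝ) ^ n • Dh b h g ϖ x) ↔ FrameEquations b y h g ϖ x := by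
  constructor
  · intro H
    refine ⟨Dh_tangentFrame_eq_zero b hs H, ?_⟩
    rw [multiContract_omegaStar_eq_iff b hy hp hs hh] at H
    have key : ∀ (a : Fin N → ℝ) (m : Comp n N),
        ∑ A, a A * ∑ μ, tau b y h μ A (sec g ϖ x) (tangentFrame g ϖ x μ)
        - ∑ μ, ∑ A, contactHam b h A (sec g ϖ x) (tangentFrame g ϖ x μ) * m μ A = 0 := by
      intro a m
      simpa only [lam_invariantField, dmom_invariantField] using
        H (invariantField 0 (lieVec b a) m _)
    refine ⟨fun A => ?_, fun A μ => ?_⟩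
    · simpa [Pi.single_apply] using key (Pi.single A 1) 0
    · simpa [Pi.single_apply, ite_apply] using key 0 (Pi.single μ (Pi.single A 1))
  · rintro ⟨-, h2, h3⟩
    rw [multiContract_omegaStar_eq_iff b hy hp hs hh]
    simp [h2, h3]

end Sections

/-! ### The Legendre transformation -/

section Legendre

variable {n N : ℕ} {G : Type*} [TopologicalSpace G] [ChartedSpace (EuclideanSpace ℝ (Fin N)) G]
  {U : Set (Base n)} {y : OpenPartialHomeomorph G (EuclideanSpace ℝ (Fin N))}

theorem hasMFDerivAt_sum {ι : Type*} (s : Finset ι) {f : ι → Jet n N G → ℝ} {p : Jet n N G}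
    {f' : ι → TJ p →L[ℝ] ℝ}
    (h : ∀ i, HasMFDerivAt (jetModel n N) 𝓘(ℝ, ℝ) (f i) p (f' i)) :
    HasMFDerivAt (jetModel n N) 𝓘(ℝ, ℝ) (fun q => ∑ i ∈ s, f i q) p
      (∑ i ∈ s, f' i : TJ p →L[ℝ] ℝ) := by
  classical
  induction s using Finset.induction_on with
  | empty => exact hasMFDerivAt_const (0 : ℝ) p
  | insert a s ha ih =>
    have h1 : (fun q => ∑ i ∈ insert a s, f i q) = f a + fun q => ∑ i ∈ s, f i q :=
      funext fun q => Finset.sum_insert ha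
    have h2 : (∑ i ∈ insert a s, f' i : TJ p →L[ℝ] ℝ) = f' a + ∑ i ∈ s, f' i :=
      Finset.sum_insert ha
    rw [h1, h2]
    exact (h a).add ih

theorem legendre_mem {l : Jet n N G → ℝ} {q : Jet n N G} (hq : q ∈ coordDomain U y) :
    legendre l q ∈ coordDomain U y := hq

theorem dFun_energy [IsManifold (𝓡 N) ∞ G] (hU : IsOpen U)
    (hy : y ∈ IsManifold.maximalAtlas (𝓡 N) ∞ G) {l : Jet n N G → ℝ}
    (hl : ContMDiffOn (jetModel n N) 𝓘(ℝ, ℝ) ∞ l (coordDomain U y)) {q : Jet n N G}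
    (hq : q ∈ coordDomain U y) (v : TJ q) :
    dFun (energy l) q v = ∑ μ, ∑ A, (partialC l μ A q * dmom μ A q v
      + q.2.2 μ A * dFun (partialC l μ A) q v) - dFun l q v := by
  have h := (hasMFDerivAt_sum Finset.univ fun μ => hasMFDerivAt_sum Finset.univ fun A =>
    (mdifferentiableAt_partialC hU hy hl μ A hq).hasMFDerivAt.mul
      (hasMFDerivAt_momentum_coord μ A q).mdifferentiableAt.hasMFDerivAt).sub
    (mdifferentiableAt_of_contMDiffOn hU hl hq).hasMFDerivAt
  refine (congrArg (fun L : TJ q →L[ℝ] ℝ => L v) h.mfderiv).trans ?_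
  change (∑ μ, ∑ A, _ : TJ q →L[ℝ] ℝ) v - _ = _
  simp only [_root_.sum_apply]
  rfl

variable [Group G] (b : Module.Basis (Fin N) ℝ (GroupLieAlgebra (𝓡 N) G))

theorem baseProj_comp_tangentLegendre {l : Jet n N G → ℝ} {q : Jet n N G}
    (hT : MDifferentiableAt (jetModel n N) (jetModel n N) (legendre l) q) :
    (baseProj (legendre l q)).comp (tangentLegendre l q) = baseProj q :=
  LinearMap.ext fun v => baseProj_comp hT v

theorem lam_comp_tangentLegendre {l : Jet n N G → ℝ} {q : Jet n N G}
    (hT : MDifferentiableAt (jetModel n N) (jetModel n N) (legendre l) q) (A : Fin N) :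
    (lam b A (legendre l q)).comp (tangentLegendre l q) = lam b A q :=
  LinearMap.ext fun v => lam_comp b hT A v

theorem dmom_comp_tangentLegendre {l : Jet n N G → ℝ} {q : Jet n N G}
    (hT : MDifferentiableAt (jetModel n N) (jetModel n N) (legendre l) q) (μ : Fin (n + 1))
    (A : Fin N) :
    (dmom μ A (legendre l q)).comp (tangentLegendre l q) = dFun (partialC l μ A) q :=
  LinearMap.ext fun v => dmom_comp hT μ A v

theorem pullForm_vol_tangentLegendre {l : Jet n N G → ℝ} {q : Jet n N G}
    (hT : MDifferentiableAt (jetModel n N) (jetModel n N) (legendre l) q) :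
    pullForm (tangentLegendre l q) (vol (legendre l q)) = vol q := by
  rw [vol_eq, vol_eq, pullForm_pullForm, baseProj_comp_tangentLegendre hT]

theorem pullForm_dnx_tangentLegendre {l : Jet n N G → ℝ} {q : Jet n N G}
    (hT : MDifferentiableAt (jetModel n N) (jetModel n N) (legendre l) q) (μ : Fin (n + 1)) :
    pullForm (tangentLegendre l q) (dnx μ (legendre l q)) = dnx μ q := by
  rw [dnx_eq, dnx_eq, pullForm_pullForm, baseProj_comp_tangentLegendre hT]

theorem pullForm_thetaHam {l h : Jet n N G → ℝ} {q : Jet n N G}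
    (hT : MDifferentiableAt (jetModel n N) (jetModel n N) (legendre l) q)
    (hlh : h (legendre l q) = energy l q) :
    pullForm (tangentLegendre l q) (thetaHam b h (legendre l q)) = thetaLag b l q := by
  simp only [thetaHam, thetaLag, map_sub, map_sum, map_mul, map_smul, pullForm_oneForm,
    pullForm_vol_tangentLegendre hT, pullForm_dnx_tangentLegendre hT,
    lam_comp_tangentLegendre b hT, hlh]
  rfl

theorem pullForm_psi {l : Jet n N G → ℝ} {q : Jet n N G}
    (hT : MDifferentiableAt (jetModel n N) (jetModel n N) (legendre l) q) (μ : Fin (n + 1)) :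
    pullForm (tangentLegendre l q) (psi b μ (legendre l q))
      = ∑ A, (oneForm (lam b A q) * oneForm (dFun (partialC l μ A) q)
        + partialC l μ A q • lamBracket b A q) := by
  simp only [psi, lamBracket, map_add, map_sum, map_mul, map_smul, pullForm_oneForm,
    lam_comp_tangentLegendre b hT, dmom_comp_tangentLegendre hT]
  rfl

theorem oneForm_dx_mul_vol (ν : Fin (n + 1)) (p : Jet n N G) : oneForm (dx ν p) * vol p = 0 := by
  rw [dx_eq, ← pullForm_oneForm, vol_eq, ← map_mul, oneForm_mul_baseVol, map_zero]

/-- Differentiating the energy produces (∂l/∂ξ) dξ twice with opposite signs. The surviving dx terms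
vanish later against ω. -/
theorem dFun_comp_tangentLegendre [LieGroup (𝓡 N) ∞ G] (hU : IsOpen U)
    (hy : y ∈ IsManifold.maximalAtlas (𝓡 N) ∞ G) {l h : Jet n N G → ℝ}
    (hl : ContMDiffOn (jetModel n N) 𝓘(ℝ, ℝ) ∞ l (coordDomain U y))
    (hh : ContMDiffOn (jetModel n N) 𝓘(ℝ, ℝ) ∞ h (coordDomain U y))
    (hlh : ∀ q ∈ coordDomain U y, h (legendre l q) = energy l q) {q : Jet n N G}
    (hq : q ∈ coordDomain U y) :
    (dFun h (legendre l q)).comp (tangentLegendre l q)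
      = ∑ μ, ∑ A, q.2.2 μ A • dFun (partialC l μ A) q - ∑ A, fibreTerm b y l A q • lam b A q
        - ∑ ν, partialX l ν q • dx ν q := by
  refine LinearMap.ext fun v => ?_
  have h1 : dFun h (legendre l q) (tangentLegendre l q v) = dFun (energy l) q v := by
    refine (dFun_comp (mdifferentiableAt_of_contMDiffOn hU hh (legendre_mem hq))
      (mdifferentiableAt_legendre hU hy hl hq) v).trans ?_
    -- The relation between h and the energy holds on an open set, so it may be differentiated.
    refine congrArg (fun L : TJ q →L[ℝ] ℝ => L v) (Filter.EventuallyEq.mfderiv_eq ?_)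
    filter_upwards [(isOpen_coordDomain hU).mem_nhds hq] with z hz using hlh z hz
  rw [LinearMap.comp_apply, h1, dFun_energy hU hy hl hq,
    dFun_apply b hy hq.2 (mdifferentiableAt_of_contMDiffOn hU hl hq)]
  simp only [LinearMap.sub_apply, LinearMap.sum_apply, LinearMap.smul_apply, smul_eq_mul,
    Finset.sum_add_distrib]
  ring

theorem pullForm_omegaHam [LieGroup (𝓡 N) ∞ G] (hU : IsOpen U)
    (hy : y ∈ IsManifold.maximalAtlas (𝓡 N) ∞ G) {l h : Jet n N G → ℝ}
    (hl : ContMDiffOn (jetModel n N) 𝓘(ℝ, ℝ) ∞ l (coordDomain U y))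
    (hh : ContMDiffOn (jetModel n N) 𝓘(ℝ, ℝ) ∞ h (coordDomain U y))
    (hlh : ∀ q ∈ coordDomain U y, h (legendre l q) = energy l q) {q : Jet n N G}
    (hq : q ∈ coordDomain U y) :
    pullForm (tangentLegendre l q) (omegaHam b h (legendre l q)) = omegaLag b y l q := by
  have hT := mdifferentiableAt_legendre hU hy hl hq
  rw [omegaHam, omegaStar, omegaLag, map_add, map_sum, map_mul, pullForm_oneForm,
    dFun_comp_tangentLegendre b hU hy hl hh hlh hq, pullForm_vol_tangentLegendre hT]
  simp only [map_mul, pullForm_psi b hT, pullForm_dnx_tangentLegendre hT, oneForm_sub, oneForm_sum,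
    oneForm_smul, sub_mul _ (∑ ν, partialX l ν q • oneForm (dx ν q)), Finset.sum_mul,
    smul_mul_assoc, oneForm_dx_mul_vol, smul_zero, Finset.sum_const_zero, sub_zero]

/-! ### The inverse Legendre transformation -/

theorem eq_of_legendre_eq {l : Jet n N G → ℝ} {q p : Jet n N G} (h : legendre l q = p) :
    q = (p.1, p.2.1, q.2.2) ∧ ∀ μ A, partialC l μ A q = p.2.2 μ A := by
  subst h
  exact ⟨rfl, fun _ _ => rfl⟩

/-- Restricted to a fibre, h is the Legendre transform of l, and its gradient is the inverse of the
gradient map of l. -/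
theorem partialC_eq_of_inverse (hU : IsOpen U) {l h : Jet n N G → ℝ}
    (hl : ContMDiffOn (jetModel n N) 𝓘(ℝ, ℝ) ∞ l (coordDomain U y))
    (hlh : ∀ q ∈ coordDomain U y, h (legendre l q) = energy l q)
    {K : Jet n N G → Jet n N G}
    (hK : ContMDiffOn (jetModel n N) (jetModel n N) ∞ K (coordDomain U y))
    (hKr : ∀ p ∈ coordDomain U y, legendre l (K p) = p) {p : Jet n N G}
    (hp : p ∈ coordDomain U y) (μ : Fin (n + 1)) (A : Fin N) :
    partialC h μ A p = (K p).2.2 μ A := by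
  -- The domain constrains only the base and group components, so it contains the whole fibre.
  have hc : ∀ c : Comp n N, ((p.1, p.2.1, c) : Jet n N G) ∈ coordDomain U y := fun c => hp
  set k : Comp n N → Comp n N := fun c => (K (p.1, p.2.1, c)).2.2 with hk
  have hKc : ∀ c, K (p.1, p.2.1, c) = (p.1, p.2.1, k c) :=
    fun c => (eq_of_legendre_eq (hKr _ (hc c))).1
  have hlk : ∀ c μ A, partialC l μ A (p.1, p.2.1, k c) = c μ A := fun c μ A => by
    rw [← hKc]; exact (eq_of_legendre_eq (hKr _ (hc c))).2 μ A
  have hinc : MDifferentiableAt 𝓘(ℝ, Comp n N) (jetModel n N)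
      (fun c : Comp n N => ((p.1, p.2.1, c) : Jet n N G)) p.2.2 :=
    mdifferentiableAt_const.prodMk (mdifferentiableAt_const.prodMk mdifferentiableAt_id)
  have hkd : DifferentiableAt ℝ k p.2.2 := by
    rw [← mdifferentiableAt_iff_differentiableAt]
    have h1 : MDifferentiableAt (jetModel n N) (jetModel n N) K p :=
      (hK.contMDiffAt ((isOpen_coordDomain hU).mem_nhds hp)).mdifferentiableAt (by simp)
    exact MDifferentiableAt.comp (g := fun q : Jet n N G => q.2.2)
      (f := fun c : Comp n N => K (p.1, p.2.1, c)) p.2.2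
      (hasMFDerivAt_momentum (K p)).mdifferentiableAt
      (MDifferentiableAt.comp (g := K) p.2.2 h1 hinc)
  have hld : DifferentiableAt ℝ (fun c : Comp n N => l (p.1, p.2.1, c)) (k p.2.2) := by
    rw [← mdifferentiableAt_iff_differentiableAt]
    exact MDifferentiableAt.comp (g := l) (k p.2.2)
      (f := fun c : Comp n N => ((p.1, p.2.1, c) : Jet n N G))
      (mdifferentiableAt_of_contMDiffOn hU hl (hc _))
      (mdifferentiableAt_const.prodMk (mdifferentiableAt_const.prodMk mdifferentiableAt_id))
  have hh : (fun c : Comp n N => h (p.1, p.2.1, c))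
      = fun c => ∑ μ, ∑ A, compProj μ A c * compProj μ A (k c) - l (p.1, p.2.1, k c) := by
    funext c
    have := hlh (K (p.1, p.2.1, c)) (by rw [hKc]; exact hc _)
    rw [hKr _ (hc c), hKc, energy] at this
    simp only [hlk] at this
    exact this
  have hd := (HasFDerivAt.fun_sum (u := Finset.univ) fun μ _ =>
    HasFDerivAt.fun_sum (u := Finset.univ) fun A _ =>
      (compProj (n := n) (N := N) μ A).hasFDerivAt.mul
        ((compProj μ A).hasFDerivAt.comp p.2.2 hkd.hasFDerivAt)).sub
    (HasFDerivAt.comp p.2.2 hld.hasFDerivAt hkd.hasFDerivAt)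
  rw [partialC, hh]
  refine (congrArg (fun L : Comp n N →L[ℝ] ℝ => L _) hd.fderiv).trans ?_
  simp only [_root_.sub_apply, _root_.sum_apply,
    _root_.add_apply, _root_.smul_apply, smul_eq_mul,
    ContinuousLinearMap.comp_apply]
  rw [clm_comp_apply (fderiv ℝ (fun c : Comp n N => l (p.1, p.2.1, c)) (k p.2.2))]
  -- At k(c) the fibre gradient of l equals c, so both terms containing the derivative of k equal c
  -- · k′ and cancel.
  have h1 : ∀ μ A, fderiv ℝ (fun c : Comp n N => l (p.1, p.2.1, c)) (k p.2.2)
      (Pi.single μ (Pi.single A 1)) = p.2.2 μ A := fun μ A => hlk p.2.2 μ A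
  simp only [h1, Finset.sum_add_distrib]
  have h2 : ∀ ν B, compProj ν B (Pi.single μ (Pi.single A 1) : Comp n N)
      = if ν = μ then if B = A then 1 else 0 else 0 := by
    intro ν B
    simp [compProj, Pi.single_apply, ite_apply]
  simp only [h2]
  simp [compProj, k]

theorem inverseLegendre_iff_eq_legendre (hU : IsOpen U) {l h : Jet n N G → ℝ}
    (hl : ContMDiffOn (jetModel n N) 𝓘(ℝ, ℝ) ∞ l (coordDomain U y))
    (hlh : ∀ q ∈ coordDomain U y, h (legendre l q) = energy l q)
    (hreg : IsHyperregular l (coordDomain U y)) {g : Base n → G} {ϖ : Base n → Comp n N}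
    (hs : ∀ x ∈ U, MDifferentiableAt 𝓘(ℝ, Base n) (jetModel n N) (sec g ϖ) x)
    (hg : ∀ x ∈ U, g x ∈ y.source) :
    InverseLegendre b h U g ϖ ↔ ∀ x ∈ U, sec g ϖ x = legendre l (jetProlong b g x) := by
  obtain ⟨K, hK, hKl, hKr⟩ := hreg
  rw [inverseLegendre_iff b hs]
  refine forall₂_congr fun x hx => ?_
  have hD : sec g ϖ x ∈ coordDomain U y := ⟨hx, hg x hx⟩
  have hj : ∀ A μ, (jetProlong b g x).2.2 μ A = lam b A (sec g ϖ x) (tangentFrame g ϖ x μ) :=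
    fun A μ => (lam_comp b (hs x hx) A (Pi.single μ 1 : Base n)).symm
  simp only [contactHam_tangentFrame b (hs x hx), partialC_eq_of_inverse hU hl hlh hK hKr hD,
    sub_eq_zero, ← hj]
  have hKs := (eq_of_legendre_eq (hKr _ hD)).1
  constructor
  · intro H
    have : jetProlong b g x = K (sec g ϖ x) := by
      rw [hKs]
      exact congrArg (fun c => (x, g x, c)) (funext fun μ => funext fun A => H A μ)
    rw [this, hKr _ hD]
  · intro H A μ
    have hjD : jetProlong b g x ∈ coordDomain U y := ⟨hx, hg x hx⟩
    rw [H, hKl _ hjD]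

end Legendre

end DeDonderWeylPoincare

end

/-! ### Assembly, with the frame equations (iv) as the hub -/

theorem mainTheorem4 {n N : ℕ} {G : Type*} [TopologicalSpace G]
    [ChartedSpace (EuclideanSpace ℝ (Fin N)) G] [Group G] [LieGroup (𝓡 N) ∞ G]
    (b : Module.Basis (Fin N) ℝ (GroupLieAlgebra (𝓡 N) G))
    (U : Set (Base n)) (hU : IsOpen U)
    (y : OpenPartialHomeomorph G (EuclideanSpace ℝ (Fin N)))
    (hy : y ∈ IsManifold.maximalAtlas (𝓡 N) ∞ G)
    (l h : Jet n N G → ℝ)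
    (hl : ContMDiffOn (jetModel n N) 𝓘(ℝ, ℝ) ∞ l
      (coordDomain U y))
    (hh : ContMDiffOn (jetModel n N) 𝓘(ℝ, ℝ) ∞ h
      (coordDomain U y))
    (hlh : ∀ q ∈ coordDomain U y,
      h (legendre l q) = energy l q) :
    (∀ q ∈ coordDomain U y,
      pullForm (tangentLegendre l q)
          (thetaHam b h (legendre l q))
        = thetaLag b l q ∧
      pullForm (tangentLegendre l q)
          (omegaHam b h (legendre l q))
        = omegaLag b y l q) ∧
    ∀ (g : Base n → G)
      (ϖ : Base n → Comp n N),
      ContMDiffOn 𝓘(ℝ, Base n) (𝓡 N) ∞ g U →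
      ContDiffOn ℝ ∞ ϖ U →
      (∀ x ∈ U, g x ∈ y.source) →
      List.TFAE [
        IsHamiltonianSection b h U
          (coordDomain U y) g ϖ,
        EnergyBalance b h U g ϖ ∧
          MomentumForm b y h U g ϖ ∧
          ContactForm b h U g ϖ,
        EnergyBalance b h U g ϖ ∧
          MomentumEquation b y h U g ϖ ∧
          InverseLegendre b h U g ϖ,
        ∀ x ∈ U,
          (∀ μ, Dh b h g ϖ x
            (tangentFrame g ϖ x μ) = 0) ∧
          (∀ A, ∑ μ, tau b y h μ A (sec g ϖ x)
            (tangentFrame g ϖ x μ) = 0) ∧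
          (∀ A μ, contactHam b h A (sec g ϖ x)
            (tangentFrame g ϖ x μ) = 0),
        ∀ x ∈ U,
          multiContract (tangentFrame g ϖ x)
              (omegaStar b (sec g ϖ x))
            = oneForm
                ((-1 : ℝ) ^ n • Dh b h g ϖ x)] ∧
      (IsHyperregular l (coordDomain U y) →
        (InverseLegendre b h U g ϖ ↔
          ∀ x ∈ U, sec g ϖ x
            = legendre l (jetProlong b g x))) := by
  refine ⟨fun q hq => ⟨pullForm_thetaHam b (mdifferentiableAt_legendre hU hy hl hq) (hlh q hq),
    pullForm_omegaHam b hU hy hl hh hlh hq⟩, fun g ϖ hg hϖ hgy => ?_⟩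
  have hs : ∀ x ∈ U, MDifferentiableAt 𝓘(ℝ, Base n) (jetModel n N) (sec g ϖ) x :=
    fun x hx => mdifferentiableAt_sec hU hg hϖ hx
  have hhd : ∀ x ∈ U, MDifferentiableAt (jetModel n N) 𝓘(ℝ, ℝ) h (sec g ϖ x) :=
    fun x hx => mdifferentiableAt_of_contMDiffOn hU hh ⟨hx, hgy x hx⟩
  refine ⟨?_, fun hreg => inverseLegendre_iff_eq_legendre b hU hl hlh hreg hs hgy⟩
  tfae_have 1 ↔ 4 := isHamiltonianSection_iff b hy _ hgy hs hhd
  tfae_have 2 ↔ 4 := by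
    rw [energyBalance_iff b hs, momentumForm_iff b hs, contactForm_iff b hs]
    exact ⟨fun H x hx => ⟨H.1 x hx, H.2.1 x hx, H.2.2 x hx⟩, fun H =>
      ⟨fun x hx => (H x hx).1, fun x hx => (H x hx).2.1, fun x hx => (H x hx).2.2⟩⟩
  tfae_have 2 ↔ 3 := by
    rw [contactForm_iff b hs, inverseLegendre_iff b hs, momentumForm_iff b hs]
    -- The two momentum equations agree only in the presence of the contact equation, which is
    -- therefore held fixed.
    exact and_congr_right fun _ => and_congr_left fun hc => (momentumEquation_iff b hs hc).symm
  tfae_have 4 ↔ 5 := forall₂_congr fun x hx =>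
    (multiContract_omegaStar_eq_iff_frameEquations b hy (hgy x hx) (hs x hx) (hhd x hx)).symm
  tfae_finish
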